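/- Let $V$ be a finite set and $\mathcal{C}\subseteq 2^V$. A non-clashing teaching map for $\mathcal{C}$ assigns to every $C\in\mathcal{C}$ a set $T(C)$ of examples from $V$, labeled positive or negative, that is consistent with $C$ (an example $x$ is labeled positive if $x\in C$ and negative if $x\notin C$), such that for all distinct $C,C'\in\mathcal{C}$ some example in $T(C)\cup T(C')$ is consistent with exactly one of $C$ and $C'$. Its size is $\max_{C\in\mathcal{C}}|T(C)|$, and $\mathrm{NCTD}(\mathcal{C})$ is the smallest size of a non-clashing teaching map for $\mathcal{C}$. In the problem N-NCTD, the input is a finite simple graph $G$, a set $\mathcal{B}$ of closed neighborhoods of vertices of $G$, and a positive integer $k$; the question is whether $\mathrm{NCTD}(\mathcal{B})\le k$. Theorem. N-NCTD is fixed-parameter tractable parameterized by the vertex cover number $\mathrm{vc}(G)$ of $G$ (the minimum size of a set of vertices that meets every edge): there are a computable function $f:\mathbb{N}\to\mathbb{N}$, a constant $d$ and an algorithm that decides every instance $(G,\mathcal{B},k)$ of N-NCTD in at most $f(\mathrm{vc}(G))\cdot n^{d}$ steps, where $n$ is the size of the input. -/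

import Mathlib

/-! ### Non-clashing teaching -/

namespace Teaching

variable {V : Type} [Fintype V] [DecidableEq V]

/-- A labeled example `(x, b)`, where `b = true` means "positive" and `b = false` means
"negative", is consistent with the concept `C` if its label says correctly whether `x ∈ C`. -/
def Consistent (e : V × Bool) (C : Finset V) : Prop :=
  e.2 = true ↔ e.1 ∈ C

/-- `T` is a non-clashing teaching map for the concept class `𝒞`: it maps every concept of `𝒞`
to a set of labeled examples (positive and negative ones are allowed) that is consistent with this
concept, and for every two distinct concepts `C, C'` of `𝒞` some example in `T C ∪ T C'` is
consistent with exactly one of `C` and `C'`. (Values of `T` outside `𝒞` are irrelevant.) -/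
def IsNCTM (𝒞 : Finset (Finset V)) (T : Finset V → Finset (V × Bool)) : Prop :=
  (∀ C ∈ 𝒞, ∀ e ∈ T C, Consistent e C) ∧
  ∀ C ∈ 𝒞, ∀ C' ∈ 𝒞, C ≠ C' →
    ∃ e ∈ T C ∪ T C', Xor (Consistent e C) (Consistent e C')

/-- The size of a teaching map: the maximum of `|T C|` over the concepts `C ∈ 𝒞`. -/
def teachingSize (𝒞 : Finset (Finset V)) (T : Finset V → Finset (V × Bool)) : ℕ :=
  𝒞.sup fun C => (T C).card

/-- The non-clashing teaching dimension: the smallest size of a non-clashing teaching map. -/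
noncomputable def NCTD (𝒞 : Finset (Finset V)) : ℕ :=
  sInf {s : ℕ | ∃ T, IsNCTM 𝒞 T ∧ teachingSize 𝒞 T = s}

/-- A non-clashing teaching map always exists, so the infimum above is a minimum. -/
theorem exists_isNCTM (𝒞 : Finset (Finset V)) : ∃ T, IsNCTM 𝒞 T := by
  refine ⟨fun C => Finset.univ.image fun x => (x, decide (x ∈ C)), ?_, ?_⟩
  · intro C _ e he
    simp only [Finset.mem_image, Finset.mem_univ, true_and] at he
    obtain ⟨x, rfl⟩ := he
    simp [Consistent]
  · intro C _ C' _ hne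
    have h : ∃ x, ¬ (x ∈ C ↔ x ∈ C') := by
      by_contra hcon
      push Not at hcon
      exact hne (Finset.ext hcon)
    obtain ⟨x, hx⟩ := h
    refine ⟨(x, decide (x ∈ C)), ?_, ?_⟩
    · exact Finset.mem_union_left _ (Finset.mem_image_of_mem _ (Finset.mem_univ x))
    · by_cases h1 : x ∈ C <;> by_cases h2 : x ∈ C' <;> simp_all [Consistent, Xor]

end Teaching

/-! ### A random access machine with a step count -/

namespace RAM

/-- Programs of a random access machine with unit-cost addition and subtraction (and no
multiplication). The machine has registers holding natural numbers and arrays of natural numbers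
that are addressed indirectly through registers; a program mentions only finitely many registers
and arrays, by fixed names in `ℕ`. -/
inductive Prog : Type where
  /-- `reg i := c` -/
  | const (i c : ℕ)
  /-- `reg i := reg j` -/
  | copy (i j : ℕ)
  /-- `reg i := reg j + reg k` -/
  | add (i j k : ℕ)
  /-- `reg i := max (reg j - reg k) 0` -/
  | sub (i j k : ℕ)
  /-- `reg i := arr a [reg j]` -/
  | load (i a j : ℕ)
  /-- `arr a [reg j] := reg i` -/
  | store (a j i : ℕ)
  /-- first `p`, then `q` -/
  | seq (p q : Prog)
  /-- if `reg i ≠ 0` then `p` else `q` -/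
  | cond (i : ℕ) (p q : Prog)
  /-- while `reg i ≠ 0` do `p` -/
  | loop (i : ℕ) (p : Prog)

/-- A memory state: contents of the registers, and of the cells of the arrays. -/
structure State where
  reg : ℕ → ℕ
  arr : ℕ → ℕ → ℕ

/-- `s` with register `i` set to `x`. -/
def State.setReg (s : State) (i x : ℕ) : State :=
  { s with reg := Function.update s.reg i x }

/-- `s` with cell `j` of array `a` set to `x`. -/
def State.setArr (s : State) (a j x : ℕ) : State :=
  { s with arr := Function.update s.arr a (Function.update (s.arr a) j x) }

/-- `Runs p s t s'`: started in state `s`, the program `p` halts in state `s'` after exactly `t`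
steps. Every elementary instruction and every test of a condition takes one step. -/
inductive Runs : Prog → State → ℕ → State → Prop where
  | const (i c : ℕ) (s : State) : Runs (.const i c) s 1 (s.setReg i c)
  | copy (i j : ℕ) (s : State) : Runs (.copy i j) s 1 (s.setReg i (s.reg j))
  | add (i j k : ℕ) (s : State) : Runs (.add i j k) s 1 (s.setReg i (s.reg j + s.reg k))
  | sub (i j k : ℕ) (s : State) : Runs (.sub i j k) s 1 (s.setReg i (s.reg j - s.reg k))
  | load (i a j : ℕ) (s : State) : Runs (.load i a j) s 1 (s.setReg i (s.arr a (s.reg j)))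
  | store (a j i : ℕ) (s : State) : Runs (.store a j i) s 1 (s.setArr a (s.reg j) (s.reg i))
  | seq {p q : Prog} {s s' s'' : State} {t t' : ℕ} :
      Runs p s t s' → Runs q s' t' s'' → Runs (.seq p q) s (t + t') s''
  | cond_true {i : ℕ} {p q : Prog} {s s' : State} {t : ℕ} :
      s.reg i ≠ 0 → Runs p s t s' → Runs (.cond i p q) s (t + 1) s'
  | cond_false {i : ℕ} {p q : Prog} {s s' : State} {t : ℕ} :
      s.reg i = 0 → Runs q s t s' → Runs (.cond i p q) s (t + 1) s'
  | loop_stop {i : ℕ} {p : Prog} {s : State} :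
      s.reg i = 0 → Runs (.loop i p) s 1 s
  | loop_step {i : ℕ} {p : Prog} {s s' s'' : State} {t t' : ℕ} :
      s.reg i ≠ 0 → Runs p s t s' → Runs (.loop i p) s' t' s'' →
        Runs (.loop i p) s (t + 1 + t') s''

/-- The initial state on the input `w`: the words of `w` are in the first cells of array `0`, and
everything else is `0`. -/
def input (w : List ℕ) : State where
  reg _ := 0
  arr a j := if a = 0 then w.getD j 0 else 0

/-- The length of an input in bits, where each word costs its binary length plus one bit for a
separator. -/
def bitLength (w : List ℕ) : ℕ :=
  (w.map fun x => Nat.size x + 1).sum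

/-- The program `p` decides on the input `w`, within at most `t` steps, whether `A` holds: it
halts with answer `1` in register `0` if `A` holds, and with answer `0` otherwise. -/
def DecidesWithin (p : Prog) (w : List ℕ) (A : Prop) (t : ℕ) : Prop :=
  ∃ (t' : ℕ) (s : State), Runs p (input w) t' s ∧ t' ≤ t ∧
    (A → s.reg 0 = 1) ∧ (¬ A → s.reg 0 = 0)

/-- The decision problem `P` on the instances `α`, presented to the machine through `enc`, is
fixed-parameter tractable for the parameter `κ`: a single program decides every instance `x` in at
most `f (κ x) * n ^ d` steps, where `n` is the bit length of the encoded instance, `f` is a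
computable function and `d` is a constant. The parameter is not part of the input. -/
def IsFPT {α : Type} (enc : α → List ℕ) (P : α → Prop) (κ : α → ℕ) : Prop :=
  ∃ (p : Prog) (f : ℕ → ℕ) (d : ℕ), Computable f ∧
    ∀ x, DecidesWithin p (enc x) (P x) (f (κ x) * bitLength (enc x) ^ d)

end RAM

/-! ### The problem N-NCTD -/

namespace NNCTD

open Classical in
/-- The closed neighborhood `N[v]`. -/
noncomputable def closedNbhd {V : Type} [Fintype V] (G : SimpleGraph V) (v : V) : Finset V :=
  Finset.univ.filter fun w => w = v ∨ G.Adj v w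

/-- An instance: a finite graph (on the vertices `0, …, n - 1`), a set `B` of closed neighborhoods
of the graph, and a positive integer `k`. -/
structure Instance where
  n : ℕ
  G : SimpleGraph (Fin n)
  B : Finset (Finset (Fin n))
  isNbhd : ∀ C ∈ B, ∃ v, C = closedNbhd G v
  k : ℕ
  k_pos : 0 < k

namespace Instance

open Classical in
/-- The encoding of an instance: the number `n` of vertices, the number `k`, the adjacency matrix
row by row, and for each vertex `v` a bit telling whether `N[v] ∈ B`. -/
noncomputable def encode (I : Instance) : List ℕ :=
  [I.n, I.k] ++
  ((List.finRange I.n).flatMap fun u =>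
    (List.finRange I.n).map fun v => if I.G.Adj u v then 1 else 0) ++
  (List.finRange I.n).map fun v => if closedNbhd I.G v ∈ I.B then 1 else 0

/-- The question: is `NCTD(B) ≤ k`? -/
def IsYes (I : Instance) : Prop :=
  Teaching.NCTD I.B ≤ I.k

/-- The vertex cover number of the graph (finite, since the graph is). -/
noncomputable def vc (I : Instance) : ℕ :=
  I.G.vertexCoverNum.toNat

end Instance

end NNCTD

/-! Labels are forced by consistency, so a teaching map is a choice of at most `k` vertices for each
concept, and `N[u]`, `N[v]` are told apart exactly by the vertices in their symmetric difference.
Call two vertices twins if they have the same open neighborhood and their closed neighborhoods are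
both in the class or both outside it. Given a vertex cover `X` of size `c`, the vertices outside `X`
form at most `2 ^ c * 2` twin classes, and large classes can be trimmed without changing the answer.

Deleting a vertex (`Teachable.erase`): a class of more than `k * deg + 2` vertices has a member that
no neighbor uses for its own teaching set. By symmetry the deleted vertex is this member, and the
remaining users of it can use another twin instead. Adding a vertex `v` (`Teachable.of_erase`): two
twins are separated only by themselves, so by double counting a large class has a member `d` in its
own teaching set, and `v` copies this set with `d` replaced by `v`.

These thresholds involve `k`. But teaching each vertex by itself and its neighbors among the first
two members of every class always works, so `k` can be capped at `lowBound` (`teachable_univ_min`),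
which is bounded in `c`. Hence so is the number of kept vertices (`card_kept_le`).

On the machine, nested counting loops (`PolyComputable`) compute the kernel in polynomial time as
four numbers: its order, the capped size, and binary codes of adjacency and of the marks. Brute
force on these numbers is primitive recursive, and a primitive recursive function has a program
whose running time is primitive recursive too (`exists_prog_of_primrec'`). An Ackermann bound makes
this time a computable function of `c`. -/

namespace RAM

/-! ### Composing programs with explicit time bounds. -/

/-- Started in `s`, the program `p` halts within `T` steps with the value `x` in register `b`,
and it changes neither the registers below `b` nor the arrays. -/
def Evaluates (p : Prog) (b : ℕ) (s : State) (T x : ℕ) : Prop :=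
  ∃ t s', Runs p s t s' ∧ t ≤ T ∧ s'.reg b = x ∧ (∀ i < b, s'.reg i = s.reg i) ∧ s'.arr = s.arr

namespace Evaluates

theorem mono {p : Prog} {b : ℕ} {s : State} {T T' x : ℕ} (h : Evaluates p b s T x) (hT : T ≤ T') :
    Evaluates p b s T' x := by
  obtain ⟨t, s', h1, h2, h3⟩ := h
  exact ⟨t, s', h1, h2.trans hT, h3⟩

theorem seq {p q : Prog} {b c : ℕ} {s : State} {T T' x y : ℕ} (hbc : b ≤ c)
    (hp : Evaluates p c s T x)
    (hq : ∀ s', s'.reg c = x → (∀ i < c, s'.reg i = s.reg i) → s'.arr = s.arr →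
      Evaluates q b s' T' y) :
    Evaluates (.seq p q) b s (T + T') y := by
  obtain ⟨t, s', h1, h2, h3, h4, h5⟩ := hp
  obtain ⟨t', s'', k1, k2, k3, k4, k5⟩ := hq s' h3 h4 h5
  exact ⟨t + t', s'', .seq h1 k1, by omega, k3,
    fun i hi => (k4 i hi).trans (h4 i (by omega)), k5.trans h5⟩

theorem setReg {p : Prog} {b : ℕ} {s : State} {x : ℕ} (h : Runs p s 1 (s.setReg b x)) :
    Evaluates p b s 1 x :=
  ⟨1, _, h, le_rfl, by simp [State.setReg],
    fun i hi => by simp [State.setReg, Function.update_of_ne hi.ne], rfl⟩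

theorem const (b c : ℕ) (s : State) : Evaluates (.const b c) b s 1 c := setReg (.const ..)

theorem copy (b i : ℕ) (s : State) : Evaluates (.copy b i) b s 1 (s.reg i) := setReg (.copy ..)

theorem add (b i j : ℕ) (s : State) : Evaluates (.add b i j) b s 1 (s.reg i + s.reg j) :=
  setReg (.add ..)

theorem sub (b i j : ℕ) (s : State) : Evaluates (.sub b i j) b s 1 (s.reg i - s.reg j) :=
  setReg (.sub ..)

theorem load (b i j : ℕ) (s : State) : Evaluates (.load b i j) b s 1 (s.arr i (s.reg j)) :=
  setReg (.load ..)

theorem cond {p q : Prog} {b i : ℕ} {s : State} {T T' x y : ℕ} (hp : Evaluates p b s T x)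
    (hq : Evaluates q b s T' y) :
    Evaluates (.cond i p q) b s (T + T' + 1) (if s.reg i = 0 then y else x) := by
  obtain ⟨t, s', h1, h2, h3, h4⟩ := hp
  obtain ⟨t', s'', k1, k2, k3, k4⟩ := hq
  by_cases h : s.reg i = 0
  · exact ⟨t' + 1, s'', .cond_false h k1, by omega, by simp [h, k3], k4⟩
  · exact ⟨t + 1, s', .cond_true h h1, by omega, by simp [h, h3], h4⟩

end Evaluates

/-- Body of a counting loop: register `b` is the accumulator, `b + 1` counts upwards, `b + 2` counts
downwards, `b + 3` holds `1` and `q` leaves the new accumulator in `b + 4`. -/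
def iterBody (b : ℕ) (q : Prog) : Prog :=
  .seq q (.seq (.copy b (b + 4)) (.seq (.add (b + 1) (b + 1) (b + 3))
    (.sub (b + 2) (b + 2) (b + 3))))

theorem runs_iterBody {b : ℕ} {q : Prog} {s : State} {T x : ℕ} (hq : Evaluates q (b + 4) s T x) :
    ∃ t s', Runs (iterBody b q) s t s' ∧ t ≤ T + 3 ∧ s'.reg b = x ∧
      s'.reg (b + 1) = s.reg (b + 1) + s.reg (b + 3) ∧
      s'.reg (b + 2) = s.reg (b + 2) - s.reg (b + 3) ∧ s'.reg (b + 3) = s.reg (b + 3) ∧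
      (∀ i < b, s'.reg i = s.reg i) ∧ s'.arr = s.arr := by
  obtain ⟨t, s', h1, h2, h3, h4, h5⟩ := hq
  refine ⟨_, _, .seq h1 (.seq (.copy ..) (.seq (.add ..) (.sub ..))), by omega, ?_, ?_, ?_, ?_, ?_,
    ?_⟩
  · simp [State.setReg, h3]
  · simp [State.setReg, h4]
  · simp [State.setReg, h4]
  · simp [State.setReg, h4]
  · intro i hi
    have : i ≠ b := by omega
    have : i ≠ b + 1 := by omega
    have : i ≠ b + 2 := by omega
    simp [State.setReg, *, h4 i (by omega)]
  · simpa [State.setReg] using h5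

/-- The loop invariant is that the accumulator equals `f` of the upward counter. The cost of a round
may depend on the counter and the accumulator, so the costs are summed along the values of `f`. -/
theorem evaluates_loop {b : ℕ} {q : Prog} {s₀ : State} {τ : ℕ → ℕ → ℕ} {f : ℕ → ℕ}
    (hq : ∀ s, (∀ i < b, s.reg i = s₀.reg i) → s.arr = s₀.arr → s.reg b = f (s.reg (b + 1)) →
      Evaluates q (b + 4) s (τ (s.reg (b + 1)) (s.reg b)) (f (s.reg (b + 1) + 1))) (N : ℕ) :
    ∀ s, (∀ i < b, s.reg i = s₀.reg i) → s.arr = s₀.arr → s.reg b = f (s.reg (b + 1)) →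
      s.reg (b + 2) = N → s.reg (b + 3) = 1 →
      Evaluates (.loop (b + 2) (iterBody b q)) b s
        ((∑ y ∈ Finset.range N, (τ (s.reg (b + 1) + y) (f (s.reg (b + 1) + y)) + 4)) + 1)
        (f (s.reg (b + 1) + N)) := by
  induction N with
  | zero =>
    intro s h1 h2 h3 h4 h5
    exact ⟨1, s, by constructor; exact h4, by simp, by simp [h3], fun _ _ => rfl, rfl⟩
  | succ N ih =>
    intro s h1 h2 h3 h4 h5
    obtain ⟨t, s', r, ht, e0, e1, e2, e3, e4, e5⟩ := runs_iterBody (hq s h1 h2 h3)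
    rw [h5] at e1 e2 e3
    rw [h4, Nat.add_sub_cancel] at e2
    obtain ⟨t', s'', r', ht', k0, k1, k2⟩ := ih s' (fun i hi => (e4 i hi).trans (h1 i hi))
      (e5.trans h2) (by rw [e0, e1]) e2 e3
    refine ⟨_, s'', .loop_step (by omega) r r', ?_, ?_, ?_, k2.trans e5⟩
    · rw [Finset.sum_range_succ']
      simp only [e1, add_zero, ← h3] at ht' ⊢
      simp only [add_assoc, add_comm 1] at ht' ⊢
      omega
    · rw [k0, e1, add_assoc, add_comm 1]
    · exact fun i hi => (k1 i hi).trans (e4 i hi)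

/-- Primitive recursion along a counter. -/
theorem evaluates_rec {b : ℕ} {p₀ pN q : Prog} {s₀ : State} {T₀ TN x₀ N : ℕ} {τ : ℕ → ℕ → ℕ}
    {G : ℕ → ℕ → ℕ} (h₀ : Evaluates p₀ b s₀ T₀ x₀)
    (hN : ∀ s, (∀ i < b, s.reg i = s₀.reg i) → s.arr = s₀.arr → Evaluates pN (b + 2) s TN N)
    (hq : ∀ s, (∀ i < b, s.reg i = s₀.reg i) → s.arr = s₀.arr →
      Evaluates q (b + 4) s (τ (s.reg (b + 1)) (s.reg b)) (G (s.reg (b + 1)) (s.reg b))) :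
    Evaluates (.seq p₀ (.seq (.const (b + 1) 0) (.seq pN (.seq (.const (b + 3) 1)
        (.loop (b + 2) (iterBody b q)))))) b s₀
      (T₀ + (1 + (TN + (1 +
        ((∑ y ∈ Finset.range N, (τ y (Nat.rec x₀ G y) + 4)) + 1)))))
      (Nat.rec x₀ G N) := by
  refine h₀.seq le_rfl fun s1 a1 b1 c1 => ?_
  refine (Evaluates.const (b + 1) 0 s1).seq (by omega) fun s2 a2 b2 c2 => ?_
  refine (hN s2 (fun i hi => (b2 i (by omega)).trans (b1 i hi)) (c2.trans c1)).seq (by omega)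
    fun s3 a3 b3 c3 => ?_
  refine (Evaluates.const (b + 3) 1 s3).seq (by omega) fun s4 a4 b4 c4 => ?_
  have e1 : s4.reg (b + 1) = 0 := by
    rw [b4 _ (by omega), b3 _ (by omega), a2]
  have := evaluates_loop (b := b) (q := q) (s₀ := s₀) (τ := τ) (f := fun y => Nat.rec x₀ G y)
    (fun s u v w => by simpa [← w] using hq s u v) N s4
    (fun i hi => by rw [b4 _ (by omega), b3 _ (by omega), b2 _ (by omega), b1 _ hi])
    (by rw [c4, c3, c2, c1])
    (by rw [e1, b4 _ (by omega), b3 _ (by omega), b2 _ (by omega), a1]; rfl)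
    (by rw [b4 _ (by omega), a3]) a4
  simpa [e1] using this

/-! ### Programs for primitive recursive functions -/

theorem primrec_sum_range {α : Type*} [Primcodable α] {N : α → ℕ} {h : α → ℕ → ℕ}
    (hN : Primrec N) (hh : Primrec₂ h) :
    Primrec fun a => ∑ y ∈ Finset.range (N a), h a y := by
  refine (Primrec.nat_rec' (h := fun a p => p.2 + h a p.1) hN (Primrec.const 0)
    (Primrec.nat_add.comp (Primrec.snd.comp Primrec.snd)
      (hh.comp Primrec.fst (Primrec.fst.comp Primrec.snd))).to₂).of_eq fun a => ?_
  induction N a with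
  | zero => rfl
  | succ n ih => rw [Finset.sum_range_succ, ← ih]

theorem primrec_sum_fin {α : Type*} [Primcodable α] {n : ℕ} {τ : Fin n → α → ℕ}
    (h : ∀ i, Primrec (τ i)) : Primrec fun a => ∑ i, τ i a := by
  induction n with
  | zero => simpa using Primrec.const 0
  | succ n ih =>
    simp only [Fin.sum_univ_succ]
    exact Primrec.nat_add.comp (h 0) (ih fun i => h i.succ)

/-- The values go into the consecutive registers `b, b + 1, …`. Each program works above the results
already stored, so neither they nor the arguments are overwritten. -/
theorem exists_prog_tuple {m n : ℕ} {g τ : Fin n → List.Vector ℕ m → ℕ}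
    (h : ∀ i, ∀ (a : Fin m → ℕ) (b : ℕ), (∀ i, a i < b) → ∃ p, ∀ s,
      Evaluates p b s (τ i (List.Vector.ofFn fun i => s.reg (a i)))
        (g i (List.Vector.ofFn fun i => s.reg (a i))))
    (a : Fin m → ℕ) (b : ℕ) (ha : ∀ i, a i < b) :
    ∃ p, ∀ s, ∃ t s', Runs p s t s' ∧
      t ≤ (∑ i, τ i (List.Vector.ofFn fun i => s.reg (a i))) + 1 ∧
      (∀ i : Fin n, s'.reg (b + i) = g i (List.Vector.ofFn fun i => s.reg (a i))) ∧
      (∀ i < b, s'.reg i = s.reg i) ∧ s'.arr = s.arr := by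
  induction n generalizing b with
  | zero =>
    refine ⟨.const b 0, fun s => ?_⟩
    obtain ⟨t, s', h1, h2, -, h4⟩ := Evaluates.const b 0 s
    exact ⟨t, s', h1, by simpa using h2, fun i => i.elim0, h4⟩
  | succ n ih =>
    obtain ⟨p, hp⟩ := h 0 a b ha
    obtain ⟨q, hq⟩ := ih (fun i => h i.succ) (b + 1) fun i => (ha i).trans (Nat.lt_succ_self b)
    refine ⟨.seq p q, fun s => ?_⟩
    obtain ⟨t, s', h1, h2, h3, h4, h5⟩ := hp s
    obtain ⟨t', s'', k1, k2, k3, k4, k5⟩ := hq s'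
    have e : (fun i => s'.reg (a i)) = fun i => s.reg (a i) := funext fun i => h4 _ (ha i)
    rw [e] at k2 k3
    refine ⟨_, s'', .seq h1 k1, ?_, ?_, ?_, k5.trans h5⟩
    · rw [Fin.sum_univ_succ]; omega
    · intro i
      refine Fin.cases ?_ (fun j => ?_) i
      · rw [Fin.val_zero, add_zero, k4 _ (by omega), h3]
      · rw [Fin.val_succ, ← k3 j, add_assoc, add_comm 1]
    · exact fun i hi => (k4 i (by omega)).trans (h4 i hi)

/-- Induction on the construction of `f`. The time bound stays primitive recursive because, for a
recursion, it is a bounded sum of the costs of the rounds, evaluated at intermediate values that are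
primitive recursive themselves. -/
theorem exists_prog_of_primrec' {n : ℕ} {f : List.Vector ℕ n → ℕ} (hf : Nat.Primrec' f) :
    ∃ τ : List.Vector ℕ n → ℕ, Primrec τ ∧ ∀ (a : Fin n → ℕ) (b : ℕ), (∀ i, a i < b) →
      ∃ p, ∀ s, Evaluates p b s (τ (List.Vector.ofFn fun i => s.reg (a i)))
        (f (List.Vector.ofFn fun i => s.reg (a i))) := by
  induction hf with
  | zero => exact ⟨fun _ => 1, Primrec.const 1, fun a b _ => ⟨.const b 0, fun s => .const ..⟩⟩
  | succ =>
    refine ⟨fun _ => 2, Primrec.const 2, fun a b h =>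
      ⟨.seq (.const b 1) (.add b (a 0) b), fun s => ?_⟩⟩
    refine (Evaluates.const b 1 s).seq (T' := 1) le_rfl fun s' h1 h2 _ => ?_
    convert Evaluates.add b (a 0) b s' using 1
    rw [h1, h2 _ (h 0)]
    rfl
  | get i =>
    refine ⟨fun _ => 1, Primrec.const 1, fun a b h => ⟨.copy b (a i), fun s => ?_⟩⟩
    simpa using Evaluates.copy b (a i) s
  | @comp m n f g hf hg ihf ihg =>
    obtain ⟨τ, hτ, H⟩ := ihf
    choose σ hσ K using ihg
    refine ⟨fun v => (∑ i, σ i v) + 1 + (τ (List.Vector.ofFn fun i => g i v) + 1), ?_, ?_⟩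
    · refine Primrec.nat_add.comp (Primrec.nat_add.comp (primrec_sum_fin hσ) (Primrec.const 1))
        (Primrec.nat_add.comp (hτ.comp (Primrec.vector_ofFn fun i => (hg i).to_prim))
          (Primrec.const 1))
    · intro a b ha
      obtain ⟨p, hp⟩ := exists_prog_tuple K a b ha
      obtain ⟨q, hq⟩ := H (fun i => b + i) (b + n) (by simp)
      refine ⟨.seq p (.seq q (.copy b (b + n))), fun s => ?_⟩
      obtain ⟨t, s', h1, h2, h3, h4, h5⟩ := hp s
      obtain ⟨t', s'', k1, k2, k3, k4, k5⟩ := (hq s').seq (b := b) (by omega) fun s'' a1 _ _ => by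
        have := Evaluates.copy b (b + n) s''
        rwa [a1] at this
      simp only [h3] at k2 k3
      exact ⟨_, s'', .seq h1 k1, by dsimp only; omega, k3, fun i hi => (k4 i hi).trans (h4 i hi),
        k5.trans h5⟩
  | @prec n f g hf hg ihf ihg =>
    obtain ⟨τ, hτ, H⟩ := ihf
    obtain ⟨σ, hσ, K⟩ := ihg
    refine ⟨fun v => τ v.tail + (1 + (1 + (1 + ((∑ y ∈ Finset.range v.head, (σ (y ::ᵥ
      (Nat.rec (f v.tail) (fun y IH => g (y ::ᵥ IH ::ᵥ v.tail)) y : ℕ) ::ᵥ v.tail) + 4)) + 1)))),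
      ?_, ?_⟩
    · have hg' : Primrec fun q : List.Vector ℕ (n + 1) × ℕ × ℕ =>
          g (q.2.1 ::ᵥ q.2.2 ::ᵥ q.1.tail) :=
        hg.to_prim.comp (Primrec.vector_cons.comp (Primrec.fst.comp Primrec.snd)
          (Primrec.vector_cons.comp (Primrec.snd.comp Primrec.snd)
            (Primrec.vector_tail.comp Primrec.fst)))
      have hrec : Primrec₂ fun (v : List.Vector ℕ (n + 1)) (y : ℕ) =>
          (Nat.rec (f v.tail) (fun y IH => g (y ::ᵥ IH ::ᵥ v.tail)) y : ℕ) :=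
        Primrec.nat_rec (hf.to_prim.comp Primrec.vector_tail) hg'.to₂
      have hs := primrec_sum_range (Primrec.vector_head (α := ℕ) (n := n))
        (h := fun v y => σ (y ::ᵥ
          (Nat.rec (f v.tail) (fun y IH => g (y ::ᵥ IH ::ᵥ v.tail)) y : ℕ) ::ᵥ v.tail) + 4)
        (Primrec.nat_add.comp (hσ.comp (Primrec.vector_cons.comp Primrec.snd
          (Primrec.vector_cons.comp hrec (Primrec.vector_tail.comp Primrec.fst))))
          (Primrec.const 4)).to₂
      have h1 := Primrec.const (α := List.Vector ℕ (n + 1)) 1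
      exact Primrec.nat_add.comp (hτ.comp Primrec.vector_tail) (Primrec.nat_add.comp h1
        (Primrec.nat_add.comp h1 (Primrec.nat_add.comp h1 (Primrec.nat_add.comp hs h1))))
    · intro a b ha
      obtain ⟨p, hp⟩ := H (fun i => a i.succ) b fun i => ha _
      -- The step function expects the counter first, which lies in `b + 1`, then the previous
      -- value, which lies in `b`.
      obtain ⟨q, hq⟩ := K (Fin.cons (b + 1) (Fin.cons b fun i => a i.succ)) (b + 4) (by
        intro i
        refine Fin.cases (by simp) (fun j => Fin.cases (by simp) (fun k => ?_) j) i
        simpa using (ha _).trans (by omega))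
      refine ⟨.seq p (.seq (.const (b + 1) 0) (.seq (.copy (b + 2) (a 0))
        (.seq (.const (b + 3) 1) (.loop (b + 2) (iterBody b q))))), fun s => ?_⟩
      have := evaluates_rec (pN := .copy (b + 2) (a 0)) (TN := 1) (N := s.reg (a 0)) (q := q)
        (τ := fun y IH => σ (y ::ᵥ IH ::ᵥ List.Vector.ofFn fun i => s.reg (a i.succ)))
        (G := fun y IH => g (y ::ᵥ IH ::ᵥ List.Vector.ofFn fun i => s.reg (a i.succ)))
        (hp s) (fun s' h1 _ => by rw [← h1 _ (ha 0)]; exact Evaluates.copy ..)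
        (fun s' h1 _ => by
          have := hq s'
          simp only [List.Vector.ofFn, Fin.cons_zero, Fin.cons_succ, h1 _ (ha _)] at this
          exact this)
      exact this

end RAM

namespace NNCTD

open Finset

/-! ### Deleting and adding twins. -/

section Kernel

variable {V : Type} (G : SimpleGraph V) (β : V → Prop)

/-- `w` belongs to exactly one of the closed neighborhoods `N[u]` and `N[v]`. -/
def Separates (u v w : V) : Prop := ¬((w = u ∨ G.Adj u w) ↔ (w = v ∨ G.Adj v w))

/-- `u` and `v` have the same open neighborhood, and both or none of them satisfies `β`. -/
def Twin (u v : V) : Prop := (∀ w, G.Adj u w ↔ G.Adj v w) ∧ (β u ↔ β v)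

/-- The closed neighborhoods, within `W`, of the vertices of `W` with the property `β` have a
non-clashing teaching map of size at most `k`. -/
def Teachable (W : Finset V) (k : ℕ) : Prop :=
  ∃ t : V → Finset V, (∀ u, t u ⊆ W) ∧ (∀ u, #(t u) ≤ k) ∧
    ∀ u ∈ W, ∀ v ∈ W, β u → β v → (∃ w ∈ W, Separates G u v w) →
      ∃ w, (w ∈ t u ∨ w ∈ t v) ∧ Separates G u v w

variable {G β}

theorem Separates.symm {u v w : V} (h : Separates G u v w) : Separates G v u w :=
  fun h' => h h'.symm

theorem Separates.ne {u v w : V} (h : Separates G u v w) : u ≠ v := by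
  rintro rfl
  exact h Iff.rfl

theorem separates_self {u v : V} (hne : u ≠ v) (h : ¬G.Adj u v) : Separates G u v u := by
  have : ¬G.Adj v u := fun h' => h h'.symm
  simp [Separates, hne, this]

namespace Twin

theorem refl (u : V) : Twin G β u u := ⟨fun _ => Iff.rfl, Iff.rfl⟩

theorem symm {u v : V} (h : Twin G β u v) : Twin G β v u := ⟨fun w => (h.1 w).symm, h.2.symm⟩

theorem trans {u v w : V} (h : Twin G β u v) (h' : Twin G β v w) : Twin G β u w :=
  ⟨fun x => (h.1 x).trans (h'.1 x), h.2.trans h'.2⟩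

theorem adj_right {u v : V} (h : Twin G β u v) (w : V) : G.Adj w u ↔ G.Adj w v := by
  rw [G.adj_comm w u, G.adj_comm w v, h.1]

theorem not_adj {u v : V} (h : Twin G β u v) : ¬G.Adj u v := by
  rw [h.1]; exact G.irrefl

theorem separates_iff {u v w w' : V} (h : Twin G β w w') (h1 : w ≠ u) (h2 : w ≠ v) (h3 : w' ≠ u)
    (h4 : w' ≠ v) : Separates G u v w ↔ Separates G u v w' := by
  simp [Separates, *, h.adj_right]

end Twin

theorem Teachable.mono {W : Finset V} {k l : ℕ} (h : Teachable G β W k) (hkl : k ≤ l) :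
    Teachable G β W l := by
  obtain ⟨t, h1, h2, h3⟩ := h
  exact ⟨t, h1, fun u => (h2 u).trans hkl, h3⟩

open Classical in
theorem exists_mem_ne_ne {D : Finset V} (h : 2 < #D) (x y : V) : ∃ z ∈ D, z ≠ x ∧ z ≠ y := by
  have h1 : #D ≤ #(D.erase x) + 1 := by have := D.pred_card_le_card_erase (a := x); omega
  have h2 : #(D.erase x) ≤ #((D.erase x).erase y) + 1 := by
    have := (D.erase x).pred_card_le_card_erase (a := y); omega
  obtain ⟨z, hz⟩ : ((D.erase x).erase y).Nonempty := by rw [← card_pos]; omega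
  simp only [mem_erase] at hz
  exact ⟨z, hz.2.2, hz.2.1, hz.1⟩

section Classical

open Classical

theorem Twin.swap [DecidableEq V] {u v : V} (h : Twin G β u v) (x : V) :
    Twin G β (Equiv.swap u v x) x := by
  rcases eq_or_ne x u with rfl | h1
  · simpa using h.symm
  rcases eq_or_ne x v with rfl | h2
  · simpa using h
  rw [Equiv.swap_apply_of_ne_of_ne h1 h2]
  exact Twin.refl x

theorem Twin.separates_swap [DecidableEq V] {u v : V} (h : Twin G β u v) (x y z : V) :
    Separates G (Equiv.swap u v x) (Equiv.swap u v y) (Equiv.swap u v z) ↔ Separates G x y z := by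
  have h' : ∀ x z, G.Adj (Equiv.swap u v x) (Equiv.swap u v z) ↔ G.Adj x z := fun x z => by
    rw [(h.swap x).1, (h.swap z).adj_right]
  simp [Separates, h']

/-- A vertex with many twins can be deleted. -/
theorem Teachable.erase [Fintype V] [DecidableEq V] {W : Finset V} {k : ℕ} {v : V} (hv : v ∈ W)
    (h : Teachable G β W k)
    (hD : k * #{w | G.Adj v w} + 2 < #{w ∈ W | Twin G β w v}) :
    Teachable G β (W.erase v) k := by
  obtain ⟨t, tW, tk, ht⟩ := h
  -- The neighbors of `v` use at most `k * deg v` vertices, so some twin `d` of `v` (possibly `v`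
  -- itself) is used by none of them.
  obtain ⟨d, hd, hdM⟩ : ∃ d ∈ ({w ∈ W | Twin G β w v} : Finset V),
      d ∉ ({w | G.Adj v w} : Finset V).biUnion t := by
    apply exists_mem_notMem_of_card_lt_card
    have : #(({w | G.Adj v w} : Finset V).biUnion t) ≤ #{w | G.Adj v w} * k :=
      card_biUnion_le_card_mul _ _ _ fun u _ => tk u
    rw [mul_comm] at this
    omega
  -- The summand `2` in the threshold leaves a twin of `v` other than `v` and `u`, which replaces
  -- `v` in the teaching set of `u`.
  choose r hr using fun u => exists_mem_ne_ne (by omega : 2 < #{w ∈ W | Twin G β w v}) v u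
  simp only [mem_filter] at hd hr
  set σ := Equiv.swap v d with hσ
  have hvd : Twin G β v d := hd.2.symm
  have σW : ∀ w ∈ W, σ w ∈ W := by
    intro w hw
    rw [hσ, Equiv.swap_apply_def]
    split_ifs
    exacts [hd.1, hv, hw]
  set t' : V → Finset V := fun u =>
    ((t (σ u)).image σ).image fun w => if w = v then r u else w with ht'
  have key : ∀ u₁ u₂ w, u₁ ≠ v → u₂ ≠ v → w ∈ t (σ u₁) → Separates G (σ u₁) (σ u₂) w →
      ∃ w' ∈ t' u₁, Separates G u₁ u₂ w' := by
    intro u₁ u₂ w h1 h2 hw hs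
    have hs' : Separates G u₁ u₂ (σ w) := by
      rw [← hvd.separates_swap, ← hσ, hσ, Equiv.swap_apply_self]
      exact hs
    refine ⟨if σ w = v then r u₁ else σ w, mem_image_of_mem _ (mem_image_of_mem _ hw), ?_⟩
    split_ifs with hwv
    · have hwd : w = d := by
        rw [← Equiv.swap_apply_self v d w, ← hσ, hwv, hσ, Equiv.swap_apply_left]
      rw [hwv] at hs'
      -- By the choice of `d`, its user `σ u₁` is no neighbor of `v`, hence neither is `u₁`. So `v`
      -- separates the pair by being adjacent to `u₂`, and its twin `r u₁` does the same.
      have hn : ¬G.Adj u₁ v := by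
        rw [← (hvd.swap u₁).1, ← hσ]
        intro hadj
        exact hdM (mem_biUnion.mpr ⟨σ u₁, by simpa using hadj.symm, hwd ▸ hw⟩)
      have hr' := (hr u₁).1.2.adj_right
      have h3 : G.Adj u₂ v := by
        simp only [Separates, h1.symm, h2.symm, hn, false_or, false_iff, not_not] at hs'
        exact hs'
      simp [Separates, (hr u₁).2.2, hr', hn, h3]
    · exact hs'
  refine ⟨t', ?_, fun u => card_image_le.trans (card_image_le.trans (tk _)), ?_⟩
  · intro u x hx
    simp only [ht', mem_image] at hx
    obtain ⟨_, ⟨w, hw, rfl⟩, rfl⟩ := hx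
    split_ifs with hwv
    · exact mem_erase.mpr ⟨(hr u).2.1, (hr u).1.1⟩
    · exact mem_erase.mpr ⟨hwv, σW _ (tW _ hw)⟩
  · rintro u₁ h₁ u₂ h₂ b₁ b₂ ⟨w, hw, hs⟩
    rw [mem_erase] at h₁ h₂ hw
    obtain ⟨x, hx | hx, hs'⟩ := ht (σ u₁) (σW _ h₁.2) (σ u₂) (σW _ h₂.2)
      ((hvd.swap u₁).2.mpr b₁) ((hvd.swap u₂).2.mpr b₂)
      ⟨σ w, σW _ hw.2, (hvd.separates_swap ..).mpr hs⟩
    · obtain ⟨y, hy, hys⟩ := key u₁ u₂ x h₁.1 h₂.1 hx hs'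
      exact ⟨y, .inl hy, hys⟩
    · obtain ⟨y, hy, hys⟩ := key u₂ u₁ x h₂.1 h₁.1 hx hs'.symm
      exact ⟨y, .inr hy, hys.symm⟩

/-- Among many twins, one is taught with the help of itself. -/
theorem exists_mem_self {D : Finset V} {t : V → Finset V} {k : ℕ} (tk : ∀ u, #(t u) ≤ k)
    (h : ∀ u ∈ D, ∀ v ∈ D, u ≠ v → u ∈ t u ∨ v ∈ t v ∨ v ∈ t u ∨ u ∈ t v)
    (hD : 2 * k + 1 < #D) : ∃ d ∈ D, d ∈ t d := by
  by_contra! hcon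
  -- Otherwise every ordered pair of distinct members lies in `P` or in its mirror image, so `#D *
  -- (#D - 1) ≤ 2 * k * #D`, which is false for `#D ≥ 2 * k + 2`.
  set P : Finset (V × V) := D.biUnion fun d => (t d).image fun x => (d, x) with hP
  have hPc : #P ≤ #D * k := card_biUnion_le_card_mul _ _ _ fun u _ => card_image_le.trans (tk u)
  have hsub : D.offDiag ⊆ P ∪ P.image Prod.swap := by
    rintro ⟨u, v⟩ huv
    rw [mem_offDiag] at huv
    obtain ⟨hu, hv, hne⟩ := huv
    simp only [hP, mem_union, mem_image, mem_biUnion, Prod.exists, Prod.swap_prod_mk]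
    rcases h u hu v hv hne with h | h | h | h
    · exact absurd h (hcon u hu)
    · exact absurd h (hcon v hv)
    · exact .inl ⟨u, hu, v, h, rfl⟩
    · exact .inr ⟨v, u, ⟨v, hv, u, h, rfl⟩, rfl⟩
  have h1 := (card_le_card hsub).trans ((card_union_le _ _).trans
    (Nat.add_le_add_left card_image_le _))
  rw [offDiag_card] at h1
  have h2 : #D * (2 * k + 2) ≤ #D * #D := Nat.mul_le_mul_left _ (by omega)
  have h3 : #D * (2 * k + 2) = 2 * (#D * k) + 2 * #D := by ring
  omega

/-- A vertex with many twins can be added. -/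
theorem Teachable.of_erase [DecidableEq V] {W : Finset V} {k : ℕ} {v : V} (hv : v ∈ W)
    (h : Teachable G β (W.erase v) k) (hD : 2 * k + 3 < #{w ∈ W | Twin G β w v}) :
    Teachable G β W k := by
  obtain ⟨t, tW, tk, ht⟩ := h
  set D : Finset V := {w ∈ W | Twin G β w v} with hDdef
  have hvD : v ∈ D := by simp [hDdef, hv, Twin.refl]
  -- Old pairs keep their witness. If a pair is separable only through `v`, a twin of `v` distinct
  -- from both vertices shows that it is already separable without `v`.
  have old : ∀ u₁ ∈ W, ∀ u₂ ∈ W, u₁ ≠ v → u₂ ≠ v → β u₁ → β u₂ →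
      (∃ w ∈ W, Separates G u₁ u₂ w) → ∃ w, (w ∈ t u₁ ∨ w ∈ t u₂) ∧ Separates G u₁ u₂ w := by
    rintro u₁ h1 u₂ h2 n1 n2 b1 b2 ⟨w, hw, hs⟩
    refine ht u₁ (mem_erase.mpr ⟨n1, h1⟩) u₂ (mem_erase.mpr ⟨n2, h2⟩) b1 b2 ?_
    rcases eq_or_ne w v with rfl | hwv
    · have hDw : 2 < #(D.erase w) := by rw [card_erase_of_mem hvD]; omega
      obtain ⟨x, hx, x1, x2⟩ := exists_mem_ne_ne hDw u₁ u₂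
      simp only [hDdef, mem_erase, mem_filter] at hx
      exact ⟨x, mem_erase.mpr ⟨hx.1, hx.2.1⟩,
        (hx.2.2.separates_iff x1 x2 n1.symm n2.symm).mpr hs⟩
    · exact ⟨w, mem_erase.mpr ⟨hwv, hw⟩, hs⟩
  by_cases hβ : β v
  swap
  -- An unmarked `v` needs no teaching set of its own.
  · refine ⟨t, fun u => (tW u).trans (erase_subset _ _), tk, fun u₁ h1 u₂ h2 b1 b2 hs => ?_⟩
    refine old u₁ h1 u₂ h2 ?_ ?_ b1 b2 hs <;> rintro rfl <;> contradiction
  obtain ⟨d, hd, hdt⟩ : ∃ d ∈ D.erase v, d ∈ t d := by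
    refine exists_mem_self tk (fun u hu x hx hne => ?_)
      (by rw [card_erase_of_mem hvD]; omega)
    simp only [hDdef, mem_erase, mem_filter] at hu hx
    have htw : Twin G β u x := hu.2.2.trans hx.2.2.symm
    obtain ⟨w, hw, hs⟩ := old u hu.2.1 x hx.2.1 hu.1 hx.1 (hu.2.2.2.mpr hβ) (hx.2.2.2.mpr hβ)
      ⟨u, hu.2.1, separates_self hne htw.not_adj⟩
    -- Twins have equal open neighborhoods, so only the twins themselves can separate them.
    have : w = u ∨ w = x := by
      by_contra hcon
      push Not at hcon
      simp [Separates, hcon, htw.1] at hs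
    rcases this with rfl | rfl <;> tauto
  simp only [hDdef, mem_erase, mem_filter] at hd
  obtain ⟨hdv, hdW, hdtw⟩ := hd
  have new : ∀ u ∈ W, u ≠ v → β u →
      ∃ w, (w ∈ insert v ((t d).erase d) ∨ w ∈ t u) ∧ Separates G v u w := by
    intro u hu huv hbu
    by_cases hadj : G.Adj v u
    swap
    · exact ⟨v, by simp, separates_self huv.symm hadj⟩
    have hdu : d ≠ u := by
      rintro rfl
      exact hdtw.symm.not_adj hadj
    obtain ⟨x, hx, x1, x2⟩ := exists_mem_ne_ne (by omega : 2 < #D) v d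
    -- The third twin `x` is adjacent to `u` but not to `d`, so the old map must separate `d` from
    -- `u`. Its witness is neither `d`, which lies in both neighborhoods, nor the absent `v`, so it
    -- separates `v` from `u` as well.
    rw [hDdef, mem_filter] at hx
    have hxu : x ≠ u := by
      rintro rfl
      exact hx.2.symm.not_adj hadj
    obtain ⟨w, hw, hs⟩ := old d hdW u hu hdv huv (hdtw.2.mpr hβ) hbu
      ⟨x, hx.1, by
        have h1 : ¬G.Adj d x := (hdtw.trans hx.2.symm).not_adj
        have h2 : G.Adj u x := by rw [hx.2.adj_right]; exact hadj.symm
        simp [Separates, x2, h1, h2]⟩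
    have hwd : w ≠ d := by
      rintro rfl
      have : G.Adj u w := by rw [hdtw.adj_right]; exact hadj.symm
      simp [Separates, this] at hs
    have hwv : w ≠ v := by
      rcases hw with hw | hw <;> exact (mem_erase.mp (tW _ hw)).1
    refine ⟨w, ?_, ?_⟩
    · rcases hw with hw | hw
      · exact .inl (by simp [hwd, hw])
      · exact .inr hw
    · simpa [Separates, hwd, hwv, hdtw.1] using hs
  refine ⟨fun u => if u = v then insert v ((t d).erase d) else t u, ?_, ?_, ?_⟩
  · intro u
    dsimp only
    split_ifs
    · exact insert_subset hv (((erase_subset _ _).trans (tW d)).trans (erase_subset _ _))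
    · exact (tW u).trans (erase_subset _ _)
  · intro u
    dsimp only
    split_ifs
    · refine (card_insert_le _ _).trans ?_
      rw [card_erase_add_one hdt]
      exact tk d
    · exact tk u
  · rintro u₁ h1 u₂ h2 b1 b2 hs
    have hne : u₁ ≠ u₂ := hs.elim fun w hw => hw.2.ne
    by_cases e1 : u₁ = v
    · subst e1
      simpa [hne.symm] using new u₂ h2 hne.symm b2
    · by_cases e2 : u₂ = v
      · subst e2
        obtain ⟨w, hw, hws⟩ := new u₁ h1 hne b1
        exact ⟨w, by simpa [e1] using hw.symm, hws.symm⟩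
      · simpa [e1, e2] using old u₁ h1 u₂ h2 e1 e2 b1 b2 hs

/-! ### Truncating the classes of twins -/

variable [Fintype V]

theorem Twin.degree_eq {u v : V} (h : Twin G β u v) :
    #{w | G.Adj u w} = #{w | G.Adj v w} := by
  simp only [h.1]

theorem degree_le {X : Finset V} (hX : G.IsVertexCover X) {v : V} (hv : v ∉ X) :
    #{w | G.Adj v w} ≤ #X :=
  card_le_card fun w hw => by simpa [hv] using hX (mem_filter.mp hw).2

variable [LinearOrder V] (G β)

/-- The number of twins of `v` below `v`. -/
noncomputable def rank (v : V) : ℕ := #{u | u < v ∧ Twin G β u v}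

/-- An upper bound for the non-clashing teaching dimension. -/
noncomputable def lowBound : ℕ := #{v | rank G β v ≤ 1} + 1

/-- In the truncation to sizes that suit `k`, the vertex `v` is kept. -/
def Kept (k : ℕ) (v : V) : Prop := rank G β v < k * #{w | G.Adj v w} + 2 * k + 3

variable {G β}

/-- Take the least twin of rank at least `r`: all of its twins below have rank less than `r`, and
there are at least `r` of them. -/
theorem le_card_twin_rank_lt {v : V} {r : ℕ} (h : r ≤ rank G β v) :
    r ≤ #{x | Twin G β x v ∧ rank G β x < r} := by
  obtain ⟨u, hu⟩ := ({x | Twin G β x v ∧ r ≤ rank G β x} : Finset V).exists_minimal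
    ⟨v, by simpa using ⟨Twin.refl v, h⟩⟩
  have hu1 := mem_filter.mp hu.1
  refine hu1.2.2.trans (card_le_card fun x hx => ?_)
  simp only [mem_filter, mem_univ, true_and] at hx ⊢
  have hxv := hx.2.trans hu1.2.1
  refine ⟨hxv, ?_⟩
  by_contra! hr
  exact absurd (hu.2 (by simpa using ⟨hxv, hr⟩) hx.1.le) (not_le.mpr hx.1)

theorem rank_lt_rank {u v : V} (h : Twin G β u v) (huv : u < v) : rank G β u < rank G β v := by
  refine card_lt_card ((ssubset_iff_of_subset fun x hx => ?_).mpr ⟨u, ?_, ?_⟩)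
  · simp only [mem_filter, mem_univ, true_and] at hx ⊢
    exact ⟨hx.1.trans huv, hx.2.trans h⟩
  · simpa using ⟨huv, h⟩
  · simp

/-- Nonadjacent vertices are separated by themselves. Adjacent `u`, `v` are separated by a neighbor
of exactly one of them, which can be moved to a low-rank twin. -/
theorem teachable_lowBound : Teachable G β univ (lowBound G β) := by
  refine ⟨fun u => insert u ({w | rank G β w ≤ 1 ∧ G.Adj u w} : Finset V),
    fun _ => subset_univ _, fun u => ?_, ?_⟩
  · refine (card_insert_le _ _).trans (Nat.succ_le_succ (card_le_card fun x => ?_))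
    simp only [mem_filter]
    tauto
  · have key : ∀ u v w, G.Adj u v → v ≠ w → G.Adj u w → ¬G.Adj v w →
        ∃ x, rank G β x ≤ 1 ∧ G.Adj u x ∧ Separates G u v x := by
      intro u v w huv hvw h1 h2
      -- Two low-rank members of the class are needed because one of them may be `v`.
      obtain ⟨x, hx, hxv, hxw⟩ : ∃ x, rank G β x ≤ 1 ∧ x ≠ v ∧ Twin G β x w := by
        by_cases hw : rank G β w ≤ 1
        · exact ⟨w, hw, hvw.symm, Twin.refl w⟩
        · have h2 := le_card_twin_rank_lt (r := 2) (not_le.mp hw)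
          obtain ⟨x, hx, hxv⟩ := exists_mem_ne (Nat.lt_of_succ_le h2) v
          simp only [mem_filter, mem_univ, true_and] at hx
          exact ⟨x, by omega, hxv, hx.1⟩
      have h3 := (hxw.adj_right u).mpr h1
      have h4 : ¬G.Adj v x := fun h => h2 ((hxw.adj_right v).mp h)
      exact ⟨x, hx, h3, by simp [Separates, h3, h4, hxv]⟩
    rintro u - v - - - ⟨w, -, hs⟩
    by_cases huv : G.Adj u v
    swap
    · exact ⟨u, by simp, separates_self hs.ne huv⟩
    have hwu : w ≠ u := by
      rintro rfl
      simp [Separates, huv.symm] at hs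
    have hwv : w ≠ v := by
      rintro rfl
      simp [Separates, huv] at hs
    simp only [Separates, hwu, hwv, false_or] at hs
    by_cases h1 : G.Adj u w
    · obtain ⟨x, x1, x2, x3⟩ := key u v w huv hwv.symm h1 (by tauto)
      exact ⟨x, by simp [x1, x2], x3⟩
    · obtain ⟨x, x1, x2, x3⟩ := key v u w huv.symm hwu.symm (by tauto) h1
      exact ⟨x, by simp [x1, x2], x3.symm⟩

theorem teachable_univ_min (k : ℕ) :
    Teachable G β univ k ↔ Teachable G β univ (min k (lowBound G β)) := by
  rcases le_total k (lowBound G β) with h | h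
  · rw [min_eq_left h]
  · rw [min_eq_right h]
    exact iff_of_true (teachable_lowBound.mono h) teachable_lowBound

/-- The dropped vertices are put back one at a time; at each step the class is large enough for both
`Teachable.erase` and `Teachable.of_erase`. -/
theorem teachable_union_kept (k : ℕ) (S : Finset V) (hS : ∀ v ∈ S, ¬Kept G β k v) :
    Teachable G β (({v | Kept G β k v} : Finset V) ∪ S) k ↔ Teachable G β {v | Kept G β k v} k := by
  induction S using Finset.induction_on with
  | empty => simp
  | @insert v S hv ih =>
    rw [← ih fun x hx => hS x (mem_insert_of_mem hx)]
    have hvK := hS v (mem_insert_self _ _)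
    set W : Finset V := ({v | Kept G β k v} : Finset V) ∪ insert v S with hW
    have hvW : v ∈ W := by simp [hW]
    have e : ({v | Kept G β k v} : Finset V) ∪ S = W.erase v := by
      rw [hW, union_insert, erase_insert]
      simp [hvK, hv]
    -- The kept twins of `v` already reach the threshold, and `v` is one more. Twins have equal
    -- degree, hence equal thresholds.
    have hcard : k * #{w | G.Adj v w} + 2 * k + 3 < #{w ∈ W | Twin G β w v} := by
      have h1 := le_card_twin_rank_lt (not_lt.mp hvK)
      refine lt_of_le_of_lt h1 (card_lt_card ((ssubset_iff_of_subset fun x hx => ?_).mpr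
        ⟨v, by simp [hvW, Twin.refl], by simpa [Kept] using fun _ => hvK⟩))
      simp only [mem_filter, mem_univ, true_and] at hx
      simp only [mem_filter, hW, mem_union, mem_univ, true_and]
      exact ⟨.inl (by rw [Kept, hx.1.degree_eq]; exact hx.2), hx.1⟩
    rw [e]
    exact ⟨fun h => h.erase hvW (by omega), fun h => h.of_erase hvW (by omega)⟩

theorem teachable_univ_iff (k : ℕ) :
    Teachable G β univ k ↔ Teachable G β {v | Kept G β k v} k := by
  rw [← teachable_union_kept k {v | ¬Kept G β k v} (by simp), filter_union_filter_not_eq]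

/-- A vertex outside `X` is determined by its neighborhood, a subset of `X`, its mark and its rank
within its twin class. -/
theorem card_le_of_rank_lt {X : Finset V} (hX : G.IsVertexCover X) {r : ℕ} {S : Finset V}
    (hS : ∀ v ∈ S, v ∉ X → rank G β v < r) : #S ≤ #X + 2 ^ #X * 2 * r := by
  have h1 : #(S \ X) ≤ #(X.powerset ×ˢ (univ : Finset Bool) ×ˢ range r) := by
    refine card_le_card_of_injOn
      (fun v => (({w | G.Adj v w} : Finset V), decide (β v), rank G β v)) ?_ ?_
    · intro v hv
      simp only [coe_sdiff, Set.mem_sdiff, mem_coe] at hv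
      simp only [mem_coe, mem_product, mem_powerset, mem_univ, mem_range, true_and]
      refine ⟨fun w hw => ?_, hS v hv.1 hv.2⟩
      simpa [hv.2] using hX (mem_filter.mp hw).2
    · intro u _ v _ huv
      simp only [Prod.mk.injEq, decide_eq_decide, Finset.ext_iff, mem_filter, mem_univ,
        true_and] at huv
      have htw : Twin G β u v := ⟨huv.1, huv.2.1⟩
      rcases lt_trichotomy u v with h | h | h
      · exact absurd huv.2.2 (rank_lt_rank htw h).ne
      · exact h
      · exact absurd huv.2.2 (rank_lt_rank htw.symm h).ne'
  have h2 := card_le_card_sdiff_add_card (s := S) (t := X)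
  simp only [card_product, card_powerset, card_univ, Fintype.card_bool, card_range] at h1
  rw [mul_assoc]
  omega

theorem lowBound_le {X : Finset V} (hX : G.IsVertexCover X) :
    lowBound G β ≤ #X + 2 ^ #X * 2 * 2 + 1 :=
  Nat.succ_le_succ (card_le_of_rank_lt (β := β) hX fun v hv _ => by
    have := (mem_filter.mp hv).2
    omega)

theorem card_kept_le {X : Finset V} (hX : G.IsVertexCover X) (k : ℕ) :
    #{v | Kept G β k v} ≤ #X + 2 ^ #X * 2 * (k * #X + 2 * k + 3) := by
  refine card_le_of_rank_lt hX fun v hv hvX => (mem_filter.mp hv).2.trans_le ?_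
  have := Nat.mul_le_mul_left k (degree_le hX hvX)
  omega

end Classical

end Kernel

/-! ### From labeled teaching maps to sets of vertices. -/

open Classical in
-- One direction forgets the labels, the other restores the forced ones, using one representative
-- vertex for each concept. Vertices with equal closed neighborhoods give the same concept and are
-- never required to be separated.
theorem Instance.isYes_iff (I : Instance) :
    I.IsYes ↔ Teachable I.G (fun v => closedNbhd I.G v ∈ I.B) univ I.k := by
  have hmem : ∀ v w, w ∈ closedNbhd I.G v ↔ w = v ∨ I.G.Adj v w := by simp [closedNbhd]
  have hsep : ∀ u v w, Separates I.G u v w ↔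
      ¬(w ∈ closedNbhd I.G u ↔ w ∈ closedNbhd I.G v) := by simp [Separates, hmem]
  have hcons : ∀ (e : Fin I.n × Bool) (C C' : Finset (Fin I.n)),
      Xor (Teaching.Consistent e C) (Teaching.Consistent e C') ↔ ¬(e.1 ∈ C ↔ e.1 ∈ C') := by
    intro e C C'
    simp only [Teaching.Consistent, Xor]
    tauto
  have hne : ({s | ∃ T, Teaching.IsNCTM I.B T ∧ Teaching.teachingSize I.B T = s}).Nonempty :=
    (Teaching.exists_isNCTM I.B).elim fun T hT => ⟨_, T, hT, rfl⟩
  constructor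
  · intro h
    obtain ⟨T, hT, hs⟩ := Nat.sInf_mem hne
    have hsize : Teaching.teachingSize I.B T ≤ I.k := hs.trans_le h
    refine ⟨fun u => if closedNbhd I.G u ∈ I.B then (T (closedNbhd I.G u)).image Prod.fst else ∅,
      fun _ => subset_univ _, fun u => ?_, ?_⟩
    · dsimp only
      split_ifs with hu
      · exact card_image_le.trans ((le_sup (f := fun C => #(T C)) hu).trans hsize)
      · simp
    · rintro u - v - hu hv ⟨w, -, hw⟩
      obtain ⟨e, he, hx⟩ := hT.2 _ hu _ hv fun heq => by simp [hsep, heq] at hw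
      rw [hcons, ← hsep] at hx
      rw [mem_union] at he
      refine ⟨e.1, ?_, hx⟩
      simp only [hu, hv, if_true]
      exact he.imp (mem_image_of_mem _) (mem_image_of_mem _)
  · rintro ⟨t, -, tk, ht⟩
    choose r hr using I.isNbhd
    set T : Finset (Fin I.n) → Finset (Fin I.n × Bool) := fun C =>
      if h : C ∈ I.B then (t (r C h)).image fun x => (x, decide (x ∈ C)) else ∅ with hT
    have hN : Teaching.IsNCTM I.B T := by
      refine ⟨fun C hC e he => ?_, fun C hC C' hC' hCC => ?_⟩
      · simp only [hT, hC, dif_pos] at he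
        obtain ⟨x, -, rfl⟩ := mem_image.mp he
        simp [Teaching.Consistent]
      · obtain ⟨w, hw⟩ : ∃ w, ¬(w ∈ C ↔ w ∈ C') := by
          by_contra! hcon
          exact hCC (Finset.ext hcon)
        have h1 := hr C hC
        have h2 := hr C' hC'
        obtain ⟨x, hx, hs⟩ := ht (r C hC) (mem_univ _) (r C' hC') (mem_univ _)
          (by simpa only [← h1] using hC) (by simpa only [← h2] using hC')
          ⟨w, mem_univ _, by rwa [hsep, ← h1, ← h2]⟩
        rw [hsep, ← h1, ← h2] at hs
        simp only [hT, hC, hC', dif_pos, mem_union]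
        rcases hx with hx | hx
        · exact ⟨(x, decide (x ∈ C)), .inl (mem_image_of_mem _ hx), (hcons ..).mpr hs⟩
        · exact ⟨(x, decide (x ∈ C')), .inr (mem_image_of_mem _ hx), (hcons ..).mpr hs⟩
    have hle : Teaching.NCTD I.B ≤ Teaching.teachingSize I.B T := Nat.sInf_le ⟨T, hN, rfl⟩
    refine hle.trans (Finset.sup_le fun C hC => ?_)
    simp only [hT, hC, dif_pos]
    exact card_image_le.trans (tk _)

end NNCTD

namespace RAM

/-! ### Functions computable by polynomially many steps of nested counting loops -/

def PolyBounded (τ : ℕ → ℕ) : Prop := ∃ C d, ∀ N, τ N ≤ C * (N + 1) ^ d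

namespace PolyBounded

theorem const (c : ℕ) : PolyBounded fun _ => c := ⟨c, 0, by simp⟩

theorem add {τ σ : ℕ → ℕ} (hτ : PolyBounded τ) (hσ : PolyBounded σ) :
    PolyBounded fun N => τ N + σ N := by
  obtain ⟨C, d, h⟩ := hτ
  obtain ⟨D, e, k⟩ := hσ
  refine ⟨C + D, d + e, fun N => ?_⟩
  rw [add_mul]
  refine Nat.add_le_add ((h N).trans ?_) ((k N).trans ?_) <;>
    exact Nat.mul_le_mul_left _ (Nat.pow_le_pow_right (by omega) (by omega))

theorem mul_self {τ : ℕ → ℕ} (hτ : PolyBounded τ) : PolyBounded fun N => N * τ N := by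
  obtain ⟨C, d, h⟩ := hτ
  refine ⟨C, d + 1, fun N => ?_⟩
  calc N * τ N ≤ (N + 1) * (C * (N + 1) ^ d) := Nat.mul_le_mul (by omega) (h N)
    _ = C * (N + 1) ^ (d + 1) := by ring

end PolyBounded

/-- The function `g` of an environment of registers and of array `0` is computable by a program
that takes a number of steps polynomial in the first entry of the array. -/
def PolyComputable (g : (ℕ → ℕ) → (ℕ → ℕ) → ℕ) : Prop :=
  ∃ τ, PolyBounded τ ∧ ∀ (a : ℕ → ℕ) (b : ℕ), (∀ i, a i < b) →
    ∃ p, ∀ s, Evaluates p b s (τ (s.arr 0 0)) (g (fun i => s.reg (a i)) (s.arr 0))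

namespace PolyComputable

theorem const (c : ℕ) : PolyComputable fun _ _ => c :=
  ⟨_, .const 1, fun _ b _ => ⟨.const b c, fun s => .const b c s⟩⟩

theorem var (i : ℕ) : PolyComputable fun ρ _ => ρ i :=
  ⟨_, .const 1, fun a b _ => ⟨.copy b (a i), fun s => .copy b (a i) s⟩⟩

theorem load {e : (ℕ → ℕ) → (ℕ → ℕ) → ℕ} (he : PolyComputable e) :
    PolyComputable fun ρ A => A (e ρ A) := by
  obtain ⟨τ, hτ, H⟩ := he
  refine ⟨_, hτ.add (.const 1), fun a b ha => ?_⟩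
  obtain ⟨p, hp⟩ := H a b ha
  refine ⟨.seq p (.load b 0 b), fun s => (hp s).seq le_rfl fun s' h1 _ h3 => ?_⟩
  have := Evaluates.load b 0 b s'
  rwa [h1, h3] at this

theorem binary {op : ℕ → ℕ → ℕ} {q : ℕ → ℕ → ℕ → Prog}
    (hq : ∀ b i j s, Evaluates (q b i j) b s 1 (op (s.reg i) (s.reg j)))
    {e e' : (ℕ → ℕ) → (ℕ → ℕ) → ℕ} (he : PolyComputable e) (he' : PolyComputable e') :
    PolyComputable fun ρ A => op (e ρ A) (e' ρ A) := by
  obtain ⟨τ, hτ, H⟩ := he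
  obtain ⟨σ, hσ, K⟩ := he'
  refine ⟨_, hτ.add (hσ.add (.const 1)), fun a b ha => ?_⟩
  obtain ⟨p, hp⟩ := H a b ha
  obtain ⟨r, hr⟩ := K a (b + 1) fun i => (ha i).trans (Nat.lt_succ_self b)
  refine ⟨.seq p (.seq r (q b b (b + 1))), fun s => (hp s).seq le_rfl fun s' h1 h2 h3 => ?_⟩
  have e1 : (fun i => s'.reg (a i)) = fun i => s.reg (a i) := funext fun i => h2 _ (ha i)
  rw [← h3, ← e1]
  refine (hr s').seq (by omega) fun s'' k1 k2 k3 => ?_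
  have := hq b b (b + 1) s''
  rwa [k1, k2 _ (by omega), h1, ← h3, ← e1] at this

theorem add {e e' : (ℕ → ℕ) → (ℕ → ℕ) → ℕ} (he : PolyComputable e) (he' : PolyComputable e') :
    PolyComputable fun ρ A => e ρ A + e' ρ A :=
  binary Evaluates.add he he'

theorem sub {e e' : (ℕ → ℕ) → (ℕ → ℕ) → ℕ} (he : PolyComputable e) (he' : PolyComputable e') :
    PolyComputable fun ρ A => e ρ A - e' ρ A :=
  binary Evaluates.sub he he'

theorem ite {c e e' : (ℕ → ℕ) → (ℕ → ℕ) → ℕ} (hc : PolyComputable c) (he : PolyComputable e)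
    (he' : PolyComputable e') : PolyComputable fun ρ A => if c ρ A = 0 then e ρ A else e' ρ A := by
  obtain ⟨τ, hτ, H⟩ := hc
  obtain ⟨σ, hσ, K⟩ := he
  obtain ⟨σ', hσ', K'⟩ := he'
  refine ⟨_, hτ.add ((hσ'.add hσ).add (.const 1)), fun a b ha => ?_⟩
  obtain ⟨p, hp⟩ := H a b ha
  obtain ⟨q, hq⟩ := K a b ha
  obtain ⟨q', hq'⟩ := K' a b ha
  refine ⟨.seq p (.cond b q' q), fun s => (hp s).seq le_rfl fun s' h1 h2 h3 => ?_⟩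
  have e1 : (fun i => s'.reg (a i)) = fun i => s.reg (a i) := funext fun i => h2 _ (ha i)
  have := Evaluates.cond (i := b) (hq' s') (hq s')
  rwa [h1, h3, e1] at this

theorem comp₂ {f : (ℕ → ℕ) → ℕ → ℕ → ℕ} (hf : PolyComputable fun ρ A => f A (ρ 0) (ρ 1))
    {e e' : (ℕ → ℕ) → (ℕ → ℕ) → ℕ} (he : PolyComputable e) (he' : PolyComputable e') :
    PolyComputable fun ρ A => f A (e ρ A) (e' ρ A) := by
  obtain ⟨τ, hτ, H⟩ := he
  obtain ⟨σ, hσ, K⟩ := he'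
  obtain ⟨σ', hσ', K'⟩ := hf
  refine ⟨_, hτ.add (hσ.add (hσ'.add (.const 1))), fun a b ha => ?_⟩
  obtain ⟨p, hp⟩ := H a b ha
  obtain ⟨q, hq⟩ := K a (b + 1) fun i => (ha i).trans (Nat.lt_succ_self b)
  -- The function reads only the variables `0` and `1`; all further variables may point to `b + 1`.
  obtain ⟨r, hr⟩ := K' (fun i => if i = 0 then b else b + 1) (b + 2) fun i => by
    split_ifs <;> omega
  refine ⟨.seq p (.seq q (.seq r (.copy b (b + 2)))), fun s =>
    (hp s).seq le_rfl fun s1 h1 h2 h3 => ?_⟩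
  have e1 : (fun i => s1.reg (a i)) = fun i => s.reg (a i) := funext fun i => h2 _ (ha i)
  rw [← h3, ← e1]
  refine (hq s1).seq (by omega) fun s2 k1 k2 k3 => ?_
  rw [← k3]
  refine (hr s2).seq (by omega) fun s3 l1 l2 l3 => ?_
  have := Evaluates.copy b (b + 2) s3
  simp only [l1, if_true, Nat.one_ne_zero, if_false, k1, k2 b (by omega), h1] at this
  rwa [← h3, ← e1, ← k3] at this

theorem comp {f : (ℕ → ℕ) → ℕ → ℕ} (hf : PolyComputable fun ρ A => f A (ρ 0))
    {e : (ℕ → ℕ) → (ℕ → ℕ) → ℕ} (he : PolyComputable e) :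
    PolyComputable fun ρ A => f A (e ρ A) :=
  comp₂ (f := fun A x _ => f A x) hf he he

/-- Inside the body the variables are shifted by two: `ρ 0` is the counter and `ρ 1` the
accumulator. The number of rounds is `A 0`, so each nesting multiplies the time by about the number
of vertices. -/
theorem iter {e : (ℕ → ℕ) → (ℕ → ℕ) → ℕ} {g : (ℕ → ℕ) → (ℕ → ℕ) → ℕ → ℕ → ℕ}
    (hg : PolyComputable fun ρ A => g (fun i => ρ (i + 2)) A (ρ 0) (ρ 1))
    (he : PolyComputable e) :
    PolyComputable fun ρ A => Nat.rec (e ρ A) (g ρ A) (A 0) := by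
  obtain ⟨τ, hτ, H⟩ := he
  obtain ⟨σ, hσ, K⟩ := hg
  refine ⟨_, hτ.add ((PolyBounded.const 1).add ((PolyBounded.const 2).add
    ((PolyBounded.const 1).add (((hσ.add (.const 4)).mul_self).add (.const 1))))),
    fun a b ha => ?_⟩
  obtain ⟨p, hp⟩ := H a b ha
  obtain ⟨q, hq⟩ := K (fun i => if i = 0 then b + 1 else if i = 1 then b else a (i - 2)) (b + 4)
    fun i => by
      have := ha (i - 2)
      split_ifs <;> omega
  refine ⟨.seq p (.seq (.const (b + 1) 0) (.seq (.seq (.const (b + 2) 0) (.load (b + 2) 0 (b + 2)))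
        (.seq (.const (b + 3) 1) (.loop (b + 2) (iterBody b q))))), fun s => ?_⟩
  have := evaluates_rec (pN := .seq (.const (b + 2) 0) (.load (b + 2) 0 (b + 2))) (TN := 2)
    (N := s.arr 0 0) (q := q) (τ := fun _ _ => σ (s.arr 0 0))
    (G := g (fun i => s.reg (a i)) (s.arr 0)) (hp s) ?_ ?_
  · simpa using this
  · intro s' _ h2
    refine (Evaluates.const (b + 2) 0 s').seq (T' := 1) le_rfl fun s'' k1 _ k3 => ?_
    have := Evaluates.load (b + 2) 0 (b + 2) s''
    rwa [k1, k3, h2] at this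
  · intro s' h1 h2
    have := hq s'
    simpa [h2, h1 _ (ha _)] using this

theorem sum {g : (ℕ → ℕ) → (ℕ → ℕ) → ℕ → ℕ}
    (hg : PolyComputable fun ρ A => g (fun i => ρ (i + 1)) A (ρ 0)) :
    PolyComputable fun ρ A => ∑ y ∈ Finset.range (A 0), g ρ A y := by
  have hg' : PolyComputable fun ρ A => g (fun i => ρ (i + 2)) A (ρ 0) := by
    obtain ⟨τ, hτ, H⟩ := hg
    refine ⟨τ, hτ, fun a b ha => ?_⟩
    obtain ⟨p, hp⟩ := H (fun i => if i = 0 then a 0 else a (i + 1)) b fun i => by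
      split_ifs <;> exact ha _
    exact ⟨p, fun s => by simpa using hp s⟩
  have := iter (g := fun ρ A y x => x + g ρ A y) ((var 1).add hg') (const 0)
  convert this using 3 with ρ A
  induction A 0 with
  | zero => rfl
  | succ n ih => rw [Finset.sum_range_succ, ih]

end PolyComputable

end RAM

namespace NNCTD

open RAM Finset

/-! ### The numbers that the algorithm computes from the input -/

section Program

variable (A : ℕ → ℕ)

/-- The sum is the product `A 0 * u`, written without multiplication because the machine has none.
-/
def adjEntry (u v : ℕ) : ℕ := A (2 + (∑ _y ∈ range (A 0), u) + v)

def bitEntry (v : ℕ) : ℕ := A (2 + (∑ _y ∈ range (A 0), A 0) + v)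

def dist (x y : ℕ) : ℕ := x - y + (y - x)

def typeDist (u v : ℕ) : ℕ :=
  (∑ w ∈ range (A 0), dist (adjEntry A u w) (adjEntry A v w)) + dist (bitEntry A u) (bitEntry A v)

/-- The truncated difference `1 - (v - u)` vanishes exactly if `u < v`. -/
def rankNum (v : ℕ) : ℕ :=
  ∑ u ∈ range (A 0), if 1 - (v - u) + typeDist A u v = 0 then 1 else 0

/-- With truncated subtraction, `x - (x - y)` is `min x y`. -/
def sizeNum : ℕ :=
  A 1 - (A 1 - ((∑ v ∈ range (A 0), if rankNum A v - 1 = 0 then 1 else 0) + 1))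

def dropNum (v : ℕ) : ℕ :=
  rankNum A v + 1 -
    ((∑ w ∈ range (A 0), if adjEntry A v w = 0 then 0 else sizeNum A) +
      (sizeNum A + sizeNum A) + 3)

def keptNum : ℕ := ∑ v ∈ range (A 0), if dropNum A v = 0 then 1 else 0

def bitCode : ℕ :=
  Nat.rec 0 (fun v x => if dropNum A v = 0 then bitEntry A v + (x + x) else x) (A 0)

/-- Horner's scheme, started at the code `x` of the rows so far, so that the rows are concatenated.
-/
def rowCode (u x : ℕ) : ℕ :=
  Nat.rec x (fun v x => if dropNum A v = 0 then adjEntry A u v + (x + x) else x) (A 0)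

def adjCode : ℕ :=
  Nat.rec 0 (fun u x => if dropNum A u = 0 then rowCode A u x else x) (A 0)

end Program

section PolyComputable

open RAM.PolyComputable

theorem polyComputable_entry (i : ℕ) : PolyComputable fun _ A => A i := load (const i)

theorem polyComputable_adjEntry : PolyComputable fun ρ A => adjEntry A (ρ 0) (ρ 1) :=
  load (((const 2).add (sum (g := fun ρ _ _ => ρ 0) (var 1))).add (var 1))

theorem polyComputable_bitEntry : PolyComputable fun ρ A => bitEntry A (ρ 0) :=
  load (((const 2).add (sum (g := fun _ A _ => A 0) (polyComputable_entry 0))).add (var 0))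

theorem polyComputable_dist : PolyComputable fun ρ _ => dist (ρ 0) (ρ 1) :=
  ((var 0).sub (var 1)).add ((var 1).sub (var 0))

theorem polyComputable_typeDist : PolyComputable fun ρ A => typeDist A (ρ 0) (ρ 1) :=
  (sum (g := fun ρ A w => dist (adjEntry A (ρ 0) w) (adjEntry A (ρ 1) w))
    (comp₂ (f := fun _ => dist) polyComputable_dist
      (comp₂ polyComputable_adjEntry (var 1) (var 0))
      (comp₂ polyComputable_adjEntry (var 2) (var 0)))).add
    (comp₂ (f := fun _ => dist) polyComputable_dist
      (comp polyComputable_bitEntry (var 0)) (comp polyComputable_bitEntry (var 1)))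

theorem polyComputable_rankNum : PolyComputable fun ρ A => rankNum A (ρ 0) :=
  sum (g := fun ρ A u => if 1 - (ρ 0 - u) + typeDist A u (ρ 0) = 0 then 1 else 0)
    (ite (((const 1).sub ((var 1).sub (var 0))).add
      (comp₂ polyComputable_typeDist (var 0) (var 1))) (const 1) (const 0))

theorem polyComputable_sizeNum : PolyComputable fun _ A => sizeNum A :=
  (polyComputable_entry 1).sub ((polyComputable_entry 1).sub
    ((sum (g := fun _ A v => if rankNum A v - 1 = 0 then 1 else 0)
      (ite ((comp polyComputable_rankNum (var 0)).sub (const 1)) (const 1) (const 0))).add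
      (const 1)))

theorem polyComputable_dropNum : PolyComputable fun ρ A => dropNum A (ρ 0) :=
  ((comp polyComputable_rankNum (var 0)).add (const 1)).sub
    (((sum (g := fun ρ A w => if adjEntry A (ρ 0) w = 0 then 0 else sizeNum A)
      (ite (comp₂ polyComputable_adjEntry (var 1) (var 0)) (const 0) polyComputable_sizeNum)).add
      (polyComputable_sizeNum.add polyComputable_sizeNum)).add (const 3))

theorem polyComputable_keptNum : PolyComputable fun _ A => keptNum A :=
  sum (g := fun _ A v => if dropNum A v = 0 then 1 else 0)
    (ite (comp polyComputable_dropNum (var 0)) (const 1) (const 0))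

theorem polyComputable_bitCode : PolyComputable fun _ A => bitCode A :=
  iter (g := fun _ A v x => if dropNum A v = 0 then bitEntry A v + (x + x) else x)
    (ite (comp polyComputable_dropNum (var 0))
      ((comp polyComputable_bitEntry (var 0)).add ((var 1).add (var 1))) (var 1)) (const 0)

theorem polyComputable_rowCode : PolyComputable fun ρ A => rowCode A (ρ 0) (ρ 1) :=
  iter (g := fun ρ A v x => if dropNum A v = 0 then adjEntry A (ρ 0) v + (x + x) else x)
    (ite (comp polyComputable_dropNum (var 0))
      ((comp₂ polyComputable_adjEntry (var 2) (var 0)).add ((var 1).add (var 1))) (var 1)) (var 1)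

theorem polyComputable_adjCode : PolyComputable fun _ A => adjCode A :=
  iter (g := fun _ A u x => if dropNum A u = 0 then rowCode A u x else x)
    (ite (comp polyComputable_dropNum (var 0))
      (comp₂ polyComputable_rowCode (var 0) (var 1)) (var 1)) (const 0)

end PolyComputable

end NNCTD

namespace NNCTD

open Finset

/-! ### The primitive recursive decision procedure for the kernel -/

/-- The digit number `i` of `x` in base `b`. -/
def digit (b x i : ℕ) : ℕ := x / b ^ i % b

/-- `Separates` in the graph on `0, …, m - 1` with the adjacency matrix coded by `M`. -/
def CodeSeparates (m M u v w : ℕ) : Prop :=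
  ¬((w = u ∨ digit 2 M (u * m + w) = 1) ↔ (w = v ∨ digit 2 M (v * m + w) = 1))

/-- `Teachable` for the graph on `0, …, m - 1` with the adjacency matrix coded by `M` and the
property of vertices coded by `B`. -/
def CodeTeachable (m k M B : ℕ) : Prop :=
  -- The `k` digits of `y` in base `m` from position `u * k` on are the vertices that teach `u`. For
  -- `m = 0` the bound is `0 ^ 0 = 1`, so `y = 0` remains available.
  ∃ y < m ^ (m * k), ∀ u < m, ∀ v < m, digit 2 B u = 1 → digit 2 B v = 1 →
    (∃ w < m, CodeSeparates m M u v w) →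
    ∃ j < k, CodeSeparates m M u v (digit m y (u * k + j)) ∨
      CodeSeparates m M u v (digit m y (v * k + j))

section Primrec

variable {α : Type} [Primcodable α]

theorem primrecPred_exists_lt {p : α → ℕ → Prop} {N : α → ℕ}
    (hp : PrimrecPred fun q : α × ℕ => p q.1 q.2) (hN : Primrec N) :
    PrimrecPred fun a => ∃ x < N a, p a x :=
  ((PrimrecRel.exists_mem_list (R := fun x a => p a x)
    (hp.comp (Primrec.pair Primrec.snd Primrec.fst))).comp (Primrec.list_range.comp hN)
      Primrec.id).of_eq (by simp)

theorem primrecPred_forall_lt {p : α → ℕ → Prop} {N : α → ℕ}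
    (hp : PrimrecPred fun q : α × ℕ => p q.1 q.2) (hN : Primrec N) :
    PrimrecPred fun a => ∀ x < N a, p a x :=
  ((PrimrecRel.forall_mem_list (R := fun x a => p a x)
    (hp.comp (Primrec.pair Primrec.snd Primrec.fst))).comp (Primrec.list_range.comp hN)
      Primrec.id).of_eq (by simp)

theorem primrecPred_imp {p q : α → Prop} (hp : PrimrecPred p) (hq : PrimrecPred q) :
    PrimrecPred fun a => p a → q a :=
  (hp.not.or hq).of_eq fun _ => imp_iff_not_or.symm

theorem primrecPred_iff {p q : α → Prop} (hp : PrimrecPred p) (hq : PrimrecPred q) :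
    PrimrecPred fun a => p a ↔ q a :=
  ((primrecPred_imp hp hq).and (primrecPred_imp hq hp)).of_eq fun _ =>
    iff_iff_implies_and_implies.symm

theorem primrec_digit {b x i : α → ℕ} (hb : Primrec b) (hx : Primrec x) (hi : Primrec i) :
    Primrec fun a => digit (b a) (x a) (i a) :=
  Primrec.nat_mod.comp (Primrec.nat_div.comp hx
    ((Primrec₂.unpaired'.mp Nat.Primrec.pow).comp hb hi)) hb

theorem primrecPred_codeSeparates {m M u v w : α → ℕ} (hm : Primrec m) (hM : Primrec M)
    (hu : Primrec u) (hv : Primrec v) (hw : Primrec w) :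
    PrimrecPred fun a => CodeSeparates (m a) (M a) (u a) (v a) (w a) := by
  have h : ∀ {u : α → ℕ}, Primrec u →
      PrimrecPred fun a => w a = u a ∨ digit 2 (M a) (u a * m a + w a) = 1 := fun hu =>
    (Primrec.eq.comp hw hu).or (Primrec.eq.comp (primrec_digit (Primrec.const 2) hM
      (Primrec.nat_add.comp (Primrec.nat_mul.comp hu hm) hw)) (Primrec.const 1))
  exact (primrecPred_iff (h hu) (h hv)).not

theorem primrecPred_codeTeachable {m k M B : α → ℕ} (hm : Primrec m) (hk : Primrec k)
    (hM : Primrec M) (hB : Primrec B) :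
    PrimrecPred fun a => CodeTeachable (m a) (k a) (M a) (B a) := by
  have F {β : Type} [Primcodable β] {f : α → ℕ} (hf : Primrec f) :
      Primrec fun q : (((α × ℕ) × ℕ) × ℕ) × β => f q.1.1.1.1 :=
    hf.comp (Primrec.fst.comp (Primrec.fst.comp (Primrec.fst.comp Primrec.fst)))
  have G {f : α → ℕ} (hf : Primrec f) : Primrec fun q : ((α × ℕ) × ℕ) × ℕ => f q.1.1.1 :=
    hf.comp (Primrec.fst.comp (Primrec.fst.comp Primrec.fst))
  have u : Primrec fun q : ((α × ℕ) × ℕ) × ℕ => q.1.2 := Primrec.snd.comp Primrec.fst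
  have v : Primrec fun q : ((α × ℕ) × ℕ) × ℕ => q.2 := Primrec.snd
  have y' : Primrec fun q : (((α × ℕ) × ℕ) × ℕ) × ℕ => q.1.1.1.2 :=
    Primrec.snd.comp (Primrec.fst.comp (Primrec.fst.comp Primrec.fst))
  have u' : Primrec fun q : (((α × ℕ) × ℕ) × ℕ) × ℕ => q.1.1.2 := u.comp Primrec.fst
  have v' : Primrec fun q : (((α × ℕ) × ℕ) × ℕ) × ℕ => q.1.2 := v.comp Primrec.fst
  have w' : Primrec fun q : (((α × ℕ) × ℕ) × ℕ) × ℕ => q.2 := Primrec.snd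
  have bit {x : ((α × ℕ) × ℕ) × ℕ → ℕ} (hx : Primrec x) :
      PrimrecPred fun q : ((α × ℕ) × ℕ) × ℕ => digit 2 (B q.1.1.1) (x q) = 1 :=
    Primrec.eq.comp (primrec_digit (Primrec.const 2) (G hB) hx) (Primrec.const 1)
  have sep {x : (((α × ℕ) × ℕ) × ℕ) × ℕ → ℕ} (hx : Primrec x) :=
    primrecPred_codeSeparates (F (β := ℕ) hm) (F hM) u' v' hx
  have dig {x : (((α × ℕ) × ℕ) × ℕ) × ℕ → ℕ} (hx : Primrec x) :=
    primrec_digit (F (β := ℕ) hm) y'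
      (Primrec.nat_add.comp (Primrec.nat_mul.comp hx (F (β := ℕ) hk)) w')
  refine primrecPred_exists_lt ?_
    ((Primrec₂.unpaired'.mp Nat.Primrec.pow).comp hm (Primrec.nat_mul.comp hm hk))
  refine primrecPred_forall_lt ?_ (hm.comp Primrec.fst)
  refine primrecPred_forall_lt ?_ (hm.comp (Primrec.fst.comp Primrec.fst))
  refine primrecPred_imp (bit u) (primrecPred_imp (bit v) (primrecPred_imp ?_ ?_))
  · exact primrecPred_exists_lt (sep w') (G hm)
  · exact primrecPred_exists_lt ((sep (dig u')).or (sep (dig v'))) (G hk)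

end Primrec

/-- A set of at most `k` vertices is padded to a `k`-tuple by repeating `u`; extra members never
spoil a teaching map. -/
theorem exists_fin_surj {m : ℕ} {s : Finset (Fin m)} {k : ℕ} (hs : #s ≤ k) (u : Fin m) :
    ∃ a : Fin k → Fin m, ∀ x ∈ s, ∃ j, a j = x := by
  refine ⟨fun j => if h : (j : ℕ) < #s then s.equivFin.symm ⟨j, h⟩ else u, fun x hx => ?_⟩
  refine ⟨⟨s.equivFin ⟨x, hx⟩, (s.equivFin ⟨x, hx⟩).2.trans_le hs⟩, ?_⟩
  simp

/-- Every table of numbers below `m` is a table of digits. -/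
theorem exists_digit_eq {m k : ℕ} (a : Fin m → Fin k → Fin m) :
    ∃ y < m ^ (m * k), ∀ (u : Fin m) (j : Fin k), digit m y (u * k + j) = a u j := by
  let y := finFunctionFinEquiv fun i : Fin (m * k) => a (finProdFinEquiv.symm i).1
    (finProdFinEquiv.symm i).2
  refine ⟨y, y.2, fun u j => ?_⟩
  have h := congr_fun (finFunctionFinEquiv.symm_apply_apply fun i : Fin (m * k) =>
    a (finProdFinEquiv.symm i).1 (finProdFinEquiv.symm i).2) (finProdFinEquiv (u, j))
  have h' := congr_arg Fin.val h
  rw [finFunctionFinEquiv_symm_apply_val] at h'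
  simp only [Equiv.symm_apply_apply, finProdFinEquiv_apply_val] at h'
  rw [← h', digit, mul_comm (u : ℕ), add_comm (k * (u : ℕ))]

theorem codeTeachable_iff {V : Type} {G : SimpleGraph V} {β : V → Prop} {W : Finset V}
    {m k M B : ℕ} {f : Fin m → V} (hf : Function.Injective f) (hW : ∀ x, x ∈ W ↔ ∃ i, f i = x)
    (hM : ∀ u w : Fin m, digit 2 M (u * m + w) = 1 ↔ G.Adj (f u) (f w))
    (hB : ∀ u : Fin m, digit 2 B u = 1 ↔ β (f u)) :
    CodeTeachable m k M B ↔ Teachable G β W k := by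
  classical
  have hsep : ∀ u v w : Fin m, CodeSeparates m M u v w ↔ Separates G (f u) (f v) (f w) := by
    intro u v w
    simp only [CodeSeparates, Separates, hM, hf.eq_iff, Fin.ext_iff]
  constructor
  · rintro ⟨y, -, hy⟩
    have hlt : ∀ (u : Fin m) i, digit m y i < m := fun u i => Nat.mod_lt _ u.pos
    refine ⟨fun x => if h : ∃ i, f i = x then
      univ.image fun j : Fin k => f ⟨digit m y (h.choose * k + j), hlt h.choose _⟩ else ∅,
      ?_, ?_, ?_⟩
    · intro x
      dsimp only
      split_ifs with h
      · intro z hz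
        obtain ⟨j, -, rfl⟩ := mem_image.mp hz
        exact (hW _).mpr ⟨_, rfl⟩
      · exact empty_subset _
    · intro x
      dsimp only
      split_ifs with h
      · exact card_image_le.trans (by simp)
      · simp
    · rintro x hx x' hx' bx bx' ⟨z, hz, hs⟩
      obtain ⟨u, rfl⟩ := (hW _).mp hx
      obtain ⟨v, rfl⟩ := (hW _).mp hx'
      obtain ⟨w, rfl⟩ := (hW _).mp hz
      have hch : ∀ u, ∀ h : ∃ i, f i = f u, h.choose = u := fun u h => hf h.choose_spec
      obtain ⟨j, hj, h⟩ := hy u u.2 v v.2 ((hB u).mpr bx) ((hB v).mpr bx')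
        ⟨w, w.2, (hsep ..).mpr hs⟩
      rcases h with h | h
      · refine ⟨f ⟨digit m y (u * k + j), hlt u _⟩, .inl ?_, (hsep ..).mp h⟩
        simp only [exists_apply_eq_apply, dif_pos, hch]
        exact mem_image_of_mem _ (mem_univ (⟨j, hj⟩ : Fin k))
      · refine ⟨f ⟨digit m y (v * k + j), hlt u _⟩, .inr ?_, (hsep ..).mp h⟩
        simp only [exists_apply_eq_apply, dif_pos, hch]
        exact mem_image_of_mem _ (mem_univ (⟨j, hj⟩ : Fin k))
  · rintro ⟨t, tW, tk, ht⟩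
    have hcard : ∀ u : Fin m, #{i : Fin m | f i ∈ t (f u)} ≤ k := fun u =>
      (card_le_card_of_injOn f (fun i hi => by simpa using hi) hf.injOn).trans (tk (f u))
    choose a ha using fun u => exists_fin_surj (hcard u) u
    obtain ⟨y, hy, hya⟩ := exists_digit_eq a
    refine ⟨y, hy, fun u hu v hv bu bv => ?_⟩
    lift u to Fin m using hu
    lift v to Fin m using hv
    rintro ⟨w, hw, hs⟩
    lift w to Fin m using hw
    obtain ⟨x, hx, hxs⟩ := ht (f u) ((hW _).mpr ⟨u, rfl⟩) (f v) ((hW _).mpr ⟨v, rfl⟩)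
      ((hB u).mp bu) ((hB v).mp bv) ⟨f w, (hW _).mpr ⟨w, rfl⟩, (hsep ..).mp hs⟩
    rcases hx with hx | hx
    · obtain ⟨i, rfl⟩ := (hW x).mp (tW _ hx)
      obtain ⟨j, rfl⟩ := ha u i (by simpa using hx)
      exact ⟨j, j.2, .inl (by rw [hya u j]; exact (hsep ..).mpr hxs)⟩
    · obtain ⟨i, rfl⟩ := (hW x).mp (tW _ hx)
      obtain ⟨j, rfl⟩ := ha v i (by simpa using hx)
      exact ⟨j, j.2, .inr (by rw [hya v j]; exact (hsep ..).mpr hxs)⟩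

end NNCTD

namespace NNCTD

open Finset RAM

/-! ### The program computes the kernel -/

theorem getElem?_flatMap_map {α β γ : Type*} (g : α → β → γ) (L' : List β) {j : ℕ}
    (hj : j < L'.length) (L : List α) (i : ℕ) (hi : i < L.length) :
    (L.flatMap fun x => L'.map (g x))[i * L'.length + j]? = some (g L[i] L'[j]) := by
  induction L generalizing i with
  | nil => simp at hi
  | cons a L ih =>
    rw [List.flatMap_cons]
    cases i with
    | zero => rw [List.getElem?_append_left (by simpa using hj)]; simp [hj]
    | succ i =>
      rw [List.getElem?_append_right (by simp only [List.length_map]; nlinarith)]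
      have : (i + 1) * L'.length + j - (L'.map (g a)).length = i * L'.length + j := by
        rw [List.length_map, add_mul]
        omega
      rw [this, ih i (by simpa using hi)]
      simp

theorem length_flatMap_map {α β γ : Type*} (g : α → β → γ) (L' : List β) (L : List α) :
    (L.flatMap fun x => L'.map (g x)).length = L.length * L'.length := by
  simp [List.length_flatMap]

theorem digit_ofDigits {ℓ : List ℕ} (h : ∀ x ∈ ℓ, x < 2) (i : ℕ) :
    digit 2 (Nat.ofDigits 2 ℓ) i = ℓ.getD i 0 := by
  rw [digit, Nat.ofDigits_div_pow_eq_ofDigits_drop i two_pos ℓ h]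
  rcases lt_or_ge i ℓ.length with hi | hi
  · rw [List.drop_eq_getElem_cons hi, Nat.ofDigits_cons]
    have := h _ (List.getElem_mem hi)
    simp only [List.getD_eq_getElem?_getD, List.getElem?_eq_getElem hi, Option.getD_some]
    omega
  · simp [List.drop_eq_nil_of_le hi, List.getElem?_eq_none hi]

/-- The numbers below `N` with `d v = 0`, in decreasing order. -/
def zeroList (d : ℕ → ℕ) (N : ℕ) : List ℕ := ((List.range N).filter (d · = 0)).reverse

theorem zeroList_succ (d : ℕ → ℕ) (N : ℕ) :
    zeroList d (N + 1) = if d N = 0 then N :: zeroList d N else zeroList d N := by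
  by_cases h : d N = 0 <;> simp [zeroList, List.range_succ, h]

theorem mem_zeroList {d : ℕ → ℕ} {N v : ℕ} : v ∈ zeroList d N ↔ v < N ∧ d v = 0 := by
  simp [zeroList]

theorem nodup_zeroList (d : ℕ → ℕ) (N : ℕ) : (zeroList d N).Nodup := by
  simpa [zeroList] using List.nodup_range.filter _

theorem sum_ite_eq_length_zeroList (d : ℕ → ℕ) (N : ℕ) :
    (∑ v ∈ range N, if d v = 0 then 1 else 0) = (zeroList d N).length := by
  induction N with
  | zero => rfl
  | succ N ih =>
    rw [sum_range_succ, ih, zeroList_succ]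
    split_ifs <;> simp

/-- Each round pushes a new lowest digit, so the vertices appear in decreasing order, as in
`zeroList`. -/
theorem rec_eq_ofDigits (d b : ℕ → ℕ) (ℓ : List ℕ) (N : ℕ) :
    (Nat.rec (Nat.ofDigits 2 ℓ) (fun v x => if d v = 0 then b v + (x + x) else x) N : ℕ) =
      Nat.ofDigits 2 ((zeroList d N).map b ++ ℓ) := by
  induction N with
  | zero => rfl
  | succ N ih =>
    rw [zeroList_succ]
    dsimp only
    rw [ih]
    split_ifs
    · rw [List.map_cons, List.cons_append, Nat.ofDigits_cons, two_mul]
    · rfl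

theorem bitCode_eq (A : ℕ → ℕ) :
    bitCode A = Nat.ofDigits 2 ((zeroList (dropNum A) (A 0)).map (bitEntry A)) :=
  (rec_eq_ofDigits (dropNum A) (bitEntry A) [] (A 0)).trans (by rw [List.append_nil])

theorem adjCode_eq (A : ℕ → ℕ) :
    adjCode A = Nat.ofDigits 2 ((zeroList (dropNum A) (A 0)).flatMap fun u =>
      (zeroList (dropNum A) (A 0)).map (adjEntry A u)) := by
  have h : ∀ N, (Nat.rec 0 (fun u x => if dropNum A u = 0 then rowCode A u x else x) N : ℕ) =
      Nat.ofDigits 2 ((zeroList (dropNum A) N).flatMap fun u =>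
        (zeroList (dropNum A) (A 0)).map (adjEntry A u)) := by
    intro N
    induction N with
    | zero => rfl
    | succ N ih =>
      rw [zeroList_succ]
      dsimp only
      rw [ih]
      split_ifs
      · exact rec_eq_ofDigits (dropNum A) (adjEntry A N) _ (A 0)
      · rfl
  exact h (A 0)

theorem keptNum_eq (A : ℕ → ℕ) : keptNum A = (zeroList (dropNum A) (A 0)).length :=
  sum_ite_eq_length_zeroList _ _

theorem dist_eq_zero {x y : ℕ} : dist x y = 0 ↔ x = y := by
  rw [dist]
  omega

namespace Instance

variable (I : Instance)

/-- The contents of array `0` on the input `I`. -/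
noncomputable def word : ℕ → ℕ := (input I.encode).arr 0

def Marked (v : Fin I.n) : Prop := closedNbhd I.G v ∈ I.B

/-- The size that the teaching maps are allowed to have in the kernel. -/
noncomputable def size : ℕ := min I.k (lowBound I.G I.Marked)

theorem word_zero : I.word 0 = I.n := rfl

theorem word_one : I.word 1 = I.k := rfl

open Classical in
theorem adjEntry_word (u v : Fin I.n) :
    adjEntry I.word u v = if I.G.Adj u v then 1 else 0 := by
  have h := getElem?_flatMap_map (fun u v : Fin I.n => if I.G.Adj u v then 1 else 0)
    (List.finRange I.n) (j := v) (by simp) (List.finRange I.n) u (by simp)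
  simp only [List.length_finRange, List.getElem_finRange] at h
  have h2 := (List.getElem?_eq_some_iff.mp h).1
  have e : 2 + (u : ℕ) * I.n + v = (u * I.n + v) + 2 := by ring
  rw [adjEntry, word_zero, sum_const, card_range, smul_eq_mul, mul_comm I.n, e]
  show I.encode.getD _ 0 = _
  rw [List.getD_eq_getElem?_getD, encode, List.append_assoc,
    List.getElem?_append_right (by simp), List.length_cons, List.length_cons, List.length_nil,
    Nat.add_sub_cancel, List.getElem?_append_left h2, h]
  rfl

open Classical in
theorem bitEntry_word (v : Fin I.n) :
    bitEntry I.word v = if I.Marked v then 1 else 0 := by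
  rw [bitEntry, word_zero, sum_const, card_range, smul_eq_mul]
  show I.encode.getD _ 0 = _
  have h : ∀ g : Fin I.n → Fin I.n → ℕ,
      ((List.finRange I.n).flatMap fun u => (List.finRange I.n).map (g u)).length = I.n * I.n :=
    fun g => by simp
  have e : 2 + I.n * I.n + v = (I.n * I.n + v) + 2 := by ring
  rw [List.getD_eq_getElem?_getD, encode, List.append_assoc, e,
    List.getElem?_append_right (by simp), List.length_cons, List.length_cons, List.length_nil,
    Nat.add_sub_cancel, List.getElem?_append_right (by rw [h]; omega), h,
    Nat.add_sub_cancel_left]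
  by_cases hv : closedNbhd I.G v ∈ I.B <;> simp [Marked, hv]

theorem typeDist_eq_zero_iff (u v : Fin I.n) :
    typeDist I.word u v = 0 ↔ Twin I.G I.Marked u v := by
  have h : ∀ (p q : Prop) [Decidable p] [Decidable q],
      ((if p then 1 else 0 : ℕ) = if q then 1 else 0) ↔ (p ↔ q) := by
    intro p q _ _
    split_ifs <;> simp [*]
  rw [typeDist, word_zero, sum_range, Nat.add_eq_zero_iff, sum_eq_zero_iff]
  simp only [dist_eq_zero, mem_univ, true_implies, adjEntry_word, bitEntry_word, h, Twin]

theorem rankNum_word (v : Fin I.n) : rankNum I.word v = rank I.G I.Marked v := by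
  classical
  rw [rankNum, word_zero, sum_range, rank, card_filter]
  refine sum_congr rfl fun u _ => if_congr ?_ rfl rfl
  rw [Nat.add_eq_zero_iff, typeDist_eq_zero_iff, Fin.lt_def]
  refine and_congr_left fun _ => ?_
  omega

theorem sizeNum_word : sizeNum I.word = I.size := by
  classical
  have h : (∑ v ∈ range I.n, if rankNum I.word v - 1 = 0 then 1 else 0) =
      #{v | rank I.G I.Marked v ≤ 1} := by
    rw [sum_range, card_filter]
    refine sum_congr rfl fun v _ => if_congr ?_ rfl rfl
    rw [rankNum_word]
    omega
  rw [sizeNum, word_zero, word_one, h, size, lowBound]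
  omega

theorem dropNum_eq_zero_iff (v : Fin I.n) :
    dropNum I.word v = 0 ↔ Kept I.G I.Marked I.size v := by
  classical
  have h : (∑ w ∈ range I.n, if adjEntry I.word v w = 0 then 0 else I.size) =
      I.size * #{w | I.G.Adj v w} := by
    rw [sum_range, card_filter, mul_sum]
    refine sum_congr rfl fun w _ => ?_
    rw [adjEntry_word]
    split_ifs <;> simp_all
  rw [dropNum, word_zero, sizeNum_word, h, rankNum_word, Kept]
  convert Nat.sub_eq_zero_iff_le using 1
  rw [Nat.succ_le_iff, two_mul]

theorem mem_zeroList_word {v : ℕ} : v ∈ zeroList (dropNum I.word) I.n ↔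
    ∃ h : v < I.n, Kept I.G I.Marked I.size ⟨v, h⟩ := by
  rw [mem_zeroList]
  refine ⟨fun h => ⟨h.1, (I.dropNum_eq_zero_iff ⟨v, h.1⟩).mp h.2⟩,
    fun ⟨h, h'⟩ => ⟨h, (I.dropNum_eq_zero_iff ⟨v, h⟩).mpr h'⟩⟩

theorem adjEntry_word_lt_two {u v : ℕ} (hu : u < I.n) (hv : v < I.n) :
    adjEntry I.word u v < 2 := by
  classical
  rw [I.adjEntry_word ⟨u, hu⟩ ⟨v, hv⟩]
  split_ifs <;> simp

theorem bitEntry_word_lt_two {v : ℕ} (hv : v < I.n) : bitEntry I.word v < 2 := by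
  classical
  rw [I.bitEntry_word ⟨v, hv⟩]
  split_ifs <;> simp

theorem adjDigits_lt_two : ∀ x ∈ (zeroList (dropNum I.word) I.n).flatMap fun u =>
    (zeroList (dropNum I.word) I.n).map (adjEntry I.word u), x < 2 := by
  intro x hx
  obtain ⟨u, hu, hx⟩ := List.mem_flatMap.mp hx
  obtain ⟨v, hv, rfl⟩ := List.mem_map.mp hx
  exact I.adjEntry_word_lt_two (mem_zeroList.mp hu).1 (mem_zeroList.mp hv).1

theorem bitDigits_lt_two : ∀ x ∈ (zeroList (dropNum I.word) I.n).map (bitEntry I.word), x < 2 := by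
  intro x hx
  obtain ⟨v, hv, rfl⟩ := List.mem_map.mp hx
  exact I.bitEntry_word_lt_two (mem_zeroList.mp hv).1

open Classical in
-- The list of kept vertices numbers the kernel: `i ↦ L[i]` is the bijection under which the digits
-- of the two codes are adjacency and marks.
theorem codeTeachable_word_iff :
    CodeTeachable (keptNum I.word) (sizeNum I.word) (adjCode I.word) (bitCode I.word) ↔
      I.IsYes := by
  have hyes : I.IsYes ↔
      Teachable I.G I.Marked {v | Kept I.G I.Marked I.size v} I.size := by
    rw [isYes_iff, ← teachable_univ_iff]
    exact teachable_univ_min I.k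
  rw [hyes, keptNum_eq, sizeNum_word, adjCode_eq, bitCode_eq, word_zero]
  have hL := fun v => I.mem_zeroList_word (v := v)
  have hnd := nodup_zeroList (dropNum I.word) I.n
  have hA := I.adjDigits_lt_two
  have hB := I.bitDigits_lt_two
  set L := zeroList (dropNum I.word) I.n
  have hlt : ∀ i : Fin L.length, L[i] < I.n := fun i => ((hL _).mp (List.getElem_mem i.2)).1
  refine codeTeachable_iff (f := fun i => ⟨L[i], hlt i⟩) ?_ ?_ ?_ ?_
  · intro i j hij
    exact Fin.ext ((hnd.getElem_inj_iff).mp (congr_arg Fin.val hij))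
  · intro x
    rw [mem_filter]
    constructor
    · rintro ⟨-, hx⟩
      obtain ⟨i, hi, h⟩ := List.getElem_of_mem ((hL x).mpr ⟨x.2, hx⟩)
      exact ⟨⟨i, hi⟩, Fin.ext h⟩
    · rintro ⟨i, rfl⟩
      exact ⟨mem_univ _, ((hL _).mp (List.getElem_mem i.2)).2⟩
  · intro u w
    rw [digit_ofDigits hA, List.getD_eq_getElem?_getD,
      getElem?_flatMap_map _ L w.2 L u u.2, Option.getD_some]
    have := I.adjEntry_word ⟨L[u], hlt u⟩ ⟨L[w], hlt w⟩
    simp only [Fin.getElem_fin] at this ⊢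
    rw [this]
    simp
  · intro u
    rw [digit_ofDigits hB, List.getD_eq_getElem?_getD, List.getElem?_map,
      List.getElem?_eq_getElem u.2, Option.map_some, Option.getD_some]
    have := I.bitEntry_word ⟨L[u], hlt u⟩
    simp only [Fin.getElem_fin] at this ⊢
    rw [this]
    simp

theorem adjCode_lt : adjCode I.word < 2 ^ (keptNum I.word * keptNum I.word) := by
  rw [adjCode_eq, keptNum_eq, ← length_flatMap_map (adjEntry I.word)]
  exact Nat.ofDigits_lt_base_pow_length one_lt_two I.adjDigits_lt_two

theorem bitCode_lt : bitCode I.word < 2 ^ keptNum I.word := by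
  rw [bitCode_eq, keptNum_eq, ← List.length_map (as := zeroList _ _) (bitEntry I.word)]
  exact Nat.ofDigits_lt_base_pow_length one_lt_two I.bitDigits_lt_two

open Classical in
theorem keptNum_word : keptNum I.word = #{v | Kept I.G I.Marked I.size v} := by
  rw [keptNum, word_zero, sum_range, card_filter]
  exact sum_congr rfl fun v _ => if_congr (I.dropNum_eq_zero_iff v) rfl rfl

theorem exists_isVertexCover : ∃ X : Finset (Fin I.n), I.G.IsVertexCover X ∧ #X = I.vc := by
  obtain ⟨X, hX, h⟩ := SimpleGraph.vertexCoverNum_exists I.G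
  refine ⟨X.toFinite.toFinset, by simpa using h, ?_⟩
  rw [vc, ← hX, ← Set.ncard_def, Set.ncard_eq_toFinset_card X]

end Instance

/-! ### Bounds in terms of the vertex cover number. -/

/-- A bound for `sizeNum` in terms of the vertex cover number. -/
def sizeBound (c : ℕ) : ℕ := c + 2 ^ c * 2 * 2 + 1

/-- A bound for `keptNum` in terms of the vertex cover number. -/
def keptBound (c : ℕ) : ℕ := c + 2 ^ c * 2 * (sizeBound c * c + 2 * sizeBound c + 3)

/-- A bound for all four numbers that describe the kernel. -/
def kernelBound (c : ℕ) : ℕ := sizeBound c + keptBound c +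
  2 ^ (keptBound c * keptBound c + keptBound c)

namespace Instance

variable (I : Instance)

theorem sizeNum_word_le : sizeNum I.word ≤ sizeBound I.vc := by
  obtain ⟨X, hX, h⟩ := I.exists_isVertexCover
  rw [sizeNum_word, size, ← h]
  exact (min_le_right _ _).trans (lowBound_le hX)

theorem keptNum_word_le : keptNum I.word ≤ keptBound I.vc := by
  have hs := I.sizeNum_word_le
  obtain ⟨X, hX, h⟩ := I.exists_isVertexCover
  rw [keptNum_word, keptBound]
  refine (card_kept_le hX _).trans ?_
  rw [sizeNum_word] at hs
  rw [h]
  gcongr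

theorem kernel_le : keptNum I.word ≤ kernelBound I.vc ∧ sizeNum I.word ≤ kernelBound I.vc ∧
    adjCode I.word ≤ kernelBound I.vc ∧ bitCode I.word ≤ kernelBound I.vc := by
  have h1 := I.keptNum_word_le
  have h2 := I.sizeNum_word_le
  have h3 : adjCode I.word ≤ 2 ^ (keptBound I.vc * keptBound I.vc + keptBound I.vc) :=
    I.adjCode_lt.le.trans (Nat.pow_le_pow_right two_pos
      ((Nat.mul_le_mul h1 h1).trans (Nat.le_add_right _ _)))
  have h4 : bitCode I.word ≤ 2 ^ (keptBound I.vc * keptBound I.vc + keptBound I.vc) :=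
    I.bitCode_lt.le.trans (Nat.pow_le_pow_right two_pos (h1.trans (Nat.le_add_left _ _)))
  rw [kernelBound]
  omega

theorem succ_le_bitLength : I.n + 1 ≤ bitLength I.encode := by
  have h : ∀ w : List ℕ, w.length ≤ bitLength w := by
    intro w
    induction w with
    | nil => simp
    | cons x w ih =>
      simp only [bitLength, List.map_cons, List.sum_cons, List.length_cons] at ih ⊢
      omega
  refine le_trans ?_ (h _)
  simp only [encode, List.length_append, List.length_map, List.length_finRange, List.length_cons]
  omega

end Instance

theorem primrec_kernelBound : Primrec kernelBound := by
  have pow : Primrec₂ ((· ^ ·) : ℕ → ℕ → ℕ) := Primrec₂.unpaired'.mp Nat.Primrec.pow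
  have two : Primrec fun _ : ℕ => 2 := Primrec.const 2
  have add {f g : ℕ → ℕ} (hf : Primrec f) (hg : Primrec g) : Primrec fun c => f c + g c :=
    Primrec.nat_add.comp hf hg
  have mul {f g : ℕ → ℕ} (hf : Primrec f) (hg : Primrec g) : Primrec fun c => f c * g c :=
    Primrec.nat_mul.comp hf hg
  have exp {f : ℕ → ℕ} (hf : Primrec f) : Primrec fun c => 2 ^ f c := pow.comp two hf
  have hs : Primrec sizeBound := add (add Primrec.id (mul (mul (exp Primrec.id) two) two))
    (Primrec.const 1)
  have hk : Primrec keptBound := add Primrec.id (mul (mul (exp Primrec.id) two)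
    (add (add (mul hs Primrec.id) (mul two hs)) (Primrec.const 3)))
  exact add (add hs hk) (exp (add (mul hk hk) hk))

/-- A primitive recursive function of four arguments is bounded by a monotone computable function
of a common bound of the arguments. -/
theorem exists_computable_bound {τ : List.Vector ℕ 4 → ℕ} (hτ : Primrec τ) :
    ∃ g : ℕ → ℕ, Computable g ∧ ∀ a b c d N, a ≤ N → b ≤ N → c ≤ N → d ≤ N →
      τ (a ::ᵥ b ::ᵥ c ::ᵥ d ::ᵥ List.Vector.nil) ≤ g N := by
  have fst : Primrec fun x : ℕ => x.unpair.1 := Primrec.fst.comp Primrec.unpair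
  have snd : Primrec fun x : ℕ => x.unpair.2 := Primrec.snd.comp Primrec.unpair
  have h : Primrec fun x : ℕ => τ (x.unpair.1.unpair.1 ::ᵥ x.unpair.1.unpair.2 ::ᵥ
      x.unpair.2.unpair.1 ::ᵥ x.unpair.2.unpair.2 ::ᵥ List.Vector.nil) :=
    hτ.comp (Primrec.vector_cons.comp (fst.comp fst) (Primrec.vector_cons.comp (snd.comp fst)
      (Primrec.vector_cons.comp (fst.comp snd) (Primrec.vector_cons.comp (snd.comp snd)
        (Primrec.const _)))))
  -- The time bound `τ` need not be monotone, but it lies below some `ack m`, which is monotone and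
  -- computable.
  obtain ⟨m, hm⟩ := exists_lt_ack_of_nat_primrec (Primrec.nat_iff.mp h)
  have hsq : Primrec fun x : ℕ => (x + 1) * (x + 1) :=
    Primrec.nat_mul.comp Primrec.succ Primrec.succ
  refine ⟨fun N => ack m (((N + 1) * (N + 1) + 1) * ((N + 1) * (N + 1) + 1)),
    computable₂_ack.comp (Computable.const m) (hsq.comp hsq).to_comp,
    fun a b c d N ha hb hc hd => ?_⟩
  have pair : ∀ {x y M}, x ≤ M → y ≤ M → Nat.pair x y ≤ (M + 1) * (M + 1) := by
    intro x y M hx hy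
    refine (Nat.pair_lt_max_add_one_sq x y).le.trans ?_
    rw [sq]
    have := max_le hx hy
    gcongr
  have := (hm (Nat.pair (Nat.pair a b) (Nat.pair c d))).le.trans
    (ack_mono_right m (pair (pair ha hb) (pair hc hd)))
  simpa using this

/-! ### The complete program. -/

open Classical in
theorem exists_program : ∃ (p : Prog) (τ : ℕ → ℕ) (g : ℕ → ℕ), PolyBounded τ ∧ Computable g ∧
    ∀ I : Instance, Evaluates p 0 (input I.encode) (τ I.n + g I.vc) (if I.IsYes then 1 else 0) := by
  obtain ⟨τ₁, hτ₁, H₁⟩ := polyComputable_keptNum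
  obtain ⟨τ₂, hτ₂, H₂⟩ := polyComputable_sizeNum
  obtain ⟨τ₃, hτ₃, H₃⟩ := polyComputable_adjCode
  obtain ⟨τ₄, hτ₄, H₄⟩ := polyComputable_bitCode
  have get (i : Fin 4) : Primrec fun v : List.Vector ℕ 4 => v.get i :=
    Primrec.vector_get.comp Primrec.id (Primrec.const i)
  obtain ⟨τ₅, hτ₅, H₅⟩ := exists_prog_of_primrec' (Nat.Primrec'.prim_iff.mpr
    (Primrec.ite (primrecPred_codeTeachable (get 0) (get 1) (get 2) (get 3))
      (Primrec.const 1) (Primrec.const 0)))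
  obtain ⟨g, hg, hgτ⟩ := exists_computable_bound hτ₅
  -- The four numbers land in registers `1` to `4` and the verdict in `5`. These functions depend on
  -- the input array only, so any register serves as environment.
  obtain ⟨p₁, h₁⟩ := H₁ (fun _ => 0) 1 (by simp)
  obtain ⟨p₂, h₂⟩ := H₂ (fun _ => 0) 2 (by simp)
  obtain ⟨p₃, h₃⟩ := H₃ (fun _ => 0) 3 (by simp)
  obtain ⟨p₄, h₄⟩ := H₄ (fun _ => 0) 4 (by simp)
  obtain ⟨p₅, h₅⟩ := H₅ (fun i => i + 1) 5 (by intro i; omega)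
  refine ⟨.seq p₁ (.seq p₂ (.seq p₃ (.seq p₄ (.seq p₅ (.copy 0 5))))), _,
    fun c => g (kernelBound c), hτ₁.add (hτ₂.add (hτ₃.add (hτ₄.add (.const 1)))),
    hg.comp primrec_kernelBound.to_comp, fun I => ?_⟩
  have hw : (input I.encode).arr 0 = I.word := rfl
  have key : Evaluates (.seq p₁ (.seq p₂ (.seq p₃ (.seq p₄ (.seq p₅ (.copy 0 5)))))) 0
      (input I.encode) (τ₁ I.n + (τ₂ I.n + (τ₃ I.n + (τ₄ I.n + (τ₅ (keptNum I.word ::ᵥ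
        sizeNum I.word ::ᵥ adjCode I.word ::ᵥ bitCode I.word ::ᵥ List.Vector.nil) + 1)))))
      (if I.IsYes then 1 else 0) := by
    refine (h₁ _).seq (by omega) fun s1 a1 b1 c1 => ?_
    have w1 : s1.arr 0 = I.word := by rw [c1, hw]
    have e2 := h₂ s1
    simp only [w1] at e2
    refine e2.seq (by omega) fun s2 a2 b2 c2 => ?_
    have w2 : s2.arr 0 = I.word := by rw [c2, w1]
    have e3 := h₃ s2
    simp only [w2] at e3
    refine e3.seq (by omega) fun s3 a3 b3 c3 => ?_
    have w3 : s3.arr 0 = I.word := by rw [c3, w2]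
    have e4 := h₄ s3
    simp only [w3] at e4
    refine e4.seq (by omega) fun s4 a4 b4 c4 => ?_
    have r1 : s4.reg 1 = keptNum I.word := by
      rw [b4 _ (by omega), b3 _ (by omega), b2 _ (by omega), a1, hw]
    have r2 : s4.reg 2 = sizeNum I.word := by rw [b4 _ (by omega), b3 _ (by omega), a2]
    have r3 : s4.reg 3 = adjCode I.word := by rw [b4 _ (by omega), a3]
    have hv : (List.Vector.ofFn fun i : Fin 4 => s4.reg (i + 1)) = keptNum I.word ::ᵥ
        sizeNum I.word ::ᵥ adjCode I.word ::ᵥ bitCode I.word ::ᵥ List.Vector.nil := by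
      rw [← r1, ← r2, ← r3, ← a4]
      rfl
    have e5 := h₅ s4
    rw [hv] at e5
    refine e5.seq (by omega) fun s5 a5 b5 c5 => ?_
    have := Evaluates.copy 0 5 s5
    rw [a5] at this
    rw [← I.codeTeachable_word_iff]
    exact this
  refine key.mono ?_
  obtain ⟨k1, k2, k3, k4⟩ := I.kernel_le
  have := hgτ _ _ _ _ _ k1 k2 k3 k4
  dsimp only
  omega

end NNCTD

theorem theorem6 :
    RAM.IsFPT NNCTD.Instance.encode NNCTD.Instance.IsYes NNCTD.Instance.vc := by
  classical
  obtain ⟨p, τ, g, ⟨C, d, hτ⟩, hg, h⟩ := NNCTD.exists_program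
  refine ⟨p, fun c => C + g c, d,
    (Primrec.nat_add.to_comp.comp (Computable.const C) hg), fun I => ?_⟩
  obtain ⟨t, s, h1, h2, h3, -⟩ := h I
  refine ⟨t, s, h1, h2.trans ?_, fun hy => by simp [h3, hy], fun hy => by simp [h3, hy]⟩
  have hb := I.succ_le_bitLength
  -- The bit length is at least `n + 1`, which absorbs the polynomial; being positive, its power
  -- also absorbs the additive term `g`.
  calc τ I.n + g I.vc
      ≤ C * RAM.bitLength I.encode ^ d + g I.vc * RAM.bitLength I.encode ^ d :=
        Nat.add_le_add ((hτ _).trans (Nat.mul_le_mul_left _ (Nat.pow_le_pow_left hb d)))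
          (Nat.le_mul_of_pos_right _ (Nat.pow_pos (by omega)))
    _ = (C + g I.vc) * RAM.bitLength I.encode ^ d := (add_mul ..).symm
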